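/- **Setting (contextual MNL bandits, adversarial contexts and rewards).** Let $1\le K\le N$ and $T\ge 1$ be integers and let $\mathcal S$ be the family of all $S\subseteq[N]$ with $1\le |S|\le K$. For $S\in\mathcal S$, $v\in[0,1]^N$ and $r\in[0,1]^N$ put $$\mu_i(S,v)=\frac{v_i}{1+\sum_{j\in S}v_j}\ (i\in S),\qquad \mu_0(S,v)=\frac1{1+\sum_{j\in S}v_j},\qquad \mu_i(S,v)=0\ (i\notin S\cup\{0\}),$$ and $R(S,v,r)=\sum_{i\in S}\mu_i(S,v)\,r_i$. There is an unknown value function $f^\star:\mathcal X\to[0,1]^N$ on a set $\mathcal X$ of contexts. In round $t=1,\dots,T$ an adversary chooses a context $x_t\in\mathcal X$ and a reward vector $r_t\in[0,1]^N$, as arbitrary functions of the past play $(S_s,i_s)_{s<t}$; the learner, who sees $x_t$ and $r_t$, offers $S_t\in\mathcal S$, and then observes $i_t\in S_t\cup\{0\}$, drawn from $\mu(S_t,f^\star(x_t))$. The regret is $$\mathbf{Reg}_{\mathsf{MNL}}=\mathbb E\Big[\sum_{t=1}^T\Big(\max_{S\in\mathcal S}R(S,f^\star(x_t),r_t)-R(S_t,f^\star(x_t),r_t)\Big)\Big].$$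 **Algorithm (Feel-Good Thompson Sampling with learning rate $\eta>0$).** The learner is given a class $\mathcal F$ of functions $\mathcal X\to[0,1]^N$ with $f^\star\in\mathcal F$, and $p_1$ is the uniform distribution on $\mathcal F$. In round $t$ it samples $f_t\sim p_t$, offers $S_t\in\operatorname{argmax}_{S\in\mathcal S}R(S,f_t(x_t),r_t)$ (ties are broken by any fixed rule, measurable in the value vector in the linear case below) and, after observing $i_t$, updates $p_{t+1}(df)\propto e^{-\eta\hat\ell_{t,f}}\,p_t(df)$, where $$\hat\ell_{t,f}=\frac1{8\eta K}\sum_{i\in S_t}\big(\mu_i(S_t,f(x_t))-\mathbf 1[i=i_t]\big)^2-\max_{S\in\mathcal S}R(S,f(x_t),r_t).$$ **Claim.** There is an absolute constant $C$ such that the following hold. 1. (Finite class.) For all $N,K,T,n$ there is $\eta>0$, depending only on these numbers, such that for every set $\mathcal X$, every finite class $\mathcal F$ with $|\mathcal F|=n$, every $f^\star\in\mathcal F$ and every adversary, $$\mathbf{Reg}_{\mathsf{MNL}}\le C\,K^{2.5}\sqrt{NT\log|\mathcal F|}.$$ 2. (Linear class.) For all $N,K,T$, all $d\ge1$ and all real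 $B>0$ there is $\eta>0$, depending only on these numbers, such that the following holds. Let $\mathcal X$ be a set of tuples $x=(x_1,\dots,x_N)$ of vectors of $\mathbb R^d$ with $\|x_i\|_2\le1$ for all $i$, and let $\mathcal F=\{f_\theta:\theta\in\mathbb R^d,\ \|\theta\|_2\le B\}$ with $f_{\theta,i}(x)=e^{\theta^\top x_i-B}$, where "uniform on $\mathcal F$" means that $\theta$ is uniform on the ball $\{\|\theta\|_2\le B\}$. Then for every $f^\star\in\mathcal F$ and every adversary, $$\mathbf{Reg}_{\mathsf{MNL}}\le C\,K^{2.5}\sqrt{dNT\,\max\{1,\log(BT)\}}.$$ -/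

import Mathlib

open MeasureTheory ProbabilityTheory

universe u

noncomputable section

namespace MNLBandit

/-- The collection `𝒮` of admissible assortments: subsets of the `N` items with at least one and
at most `K` elements. -/
def assortments (N K : ℕ) : Finset (Finset (Fin N)) :=
  Finset.univ.filter fun S => 1 ≤ S.card ∧ S.card ≤ K

/-- The multinomial logit probabilities `μ(S, v)`. The outcome `none` is the no-purchase option
(item `0`, of value `1`), and `some i` is the purchase of item `i`. -/
def mnlProb {N : ℕ} (S : Finset (Fin N)) (v : Fin N → ℝ) : Option (Fin N) → ℝ
  | none => 1 / (1 + ∑ j ∈ S, v j)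
  | some i => if i ∈ S then v i / (1 + ∑ j ∈ S, v j) else 0

/-- The expected reward `R(S, v, r)` of the assortment `S` (no purchase gives no reward). -/
def expReward {N : ℕ} (S : Finset (Fin N)) (v r : Fin N → ℝ) : ℝ :=
  ∑ i ∈ S, mnlProb S v (some i) * r i

/-- `max_{S ∈ 𝒮} R(S, v, r)`; the supremum is over a finite set, nonempty when `1 ≤ K ≤ N`. -/
def bestReward {N : ℕ} (K : ℕ) (v r : Fin N → ℝ) : ℝ :=
  ⨆ S : {S : Finset (Fin N) // S ∈ assortments N K}, expReward S.1 v r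

/-- One round of play: the assortment offered and the purchase decision observed. -/
abbrev Round (N : ℕ) : Type := Finset (Fin N) × Option (Fin N)

/-- The play so far, most recent round first. -/
abbrev History (N : ℕ) : Type := List (Round N)

/-- An adaptive adversary. In the round that follows the history `h` (round number `h.length + 1`)
the context is `context h` and the reward vector is `reward h ∈ [0,1]^N`. A fixed sequence of
contexts and rewards is the case in which both depend on `h.length` only; an adversary with
randomness of its own is a mixture of adversaries of this form. -/
structure Adversary (X : Type u) (N : ℕ) where
  context : History N → X
  reward : History N → Fin N → ℝ
  reward_mem : ∀ h i, reward h i ∈ Set.Icc (0 : ℝ) 1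

/-- `select` is a rule for `argmax_{S ∈ 𝒮} R(S, v, r)`, with ties broken in any way. -/
def IsArgmaxRule {N : ℕ} (K : ℕ)
    (select : (Fin N → ℝ) → (Fin N → ℝ) → Finset (Fin N)) : Prop :=
  ∀ v r : Fin N → ℝ, (∀ i, v i ∈ Set.Icc (0 : ℝ) 1) → (∀ i, r i ∈ Set.Icc (0 : ℝ) 1) →
    select v r ∈ assortments N K ∧
      ∀ S ∈ assortments N K, expReward S v r ≤ expReward (select v r) v r

/-- The feel-good loss estimator of a value vector `v = f(x_t)`, after the assortment `S` was
offered under rewards `r` and the purchase decision was `o`. -/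
def fgLoss {N : ℕ} (K : ℕ) (η : ℝ) (S : Finset (Fin N)) (o : Option (Fin N))
    (v r : Fin N → ℝ) : ℝ :=
  1 / (8 * η * K) * ∑ i ∈ S, (mnlProb S v (some i) - if o = some i then 1 else 0) ^ 2
    - bestReward K v r

section Algorithm

variable {Θ : Type} [MeasurableSpace Θ] {X : Type u} {N : ℕ}

/-- The distribution `p_t` that Feel-Good Thompson Sampling with learning rate `η` has after the
history, over a function class parametrised by `value : Θ → X → ℝ^N`. It starts from `prior`,
and every round multiplies the density by `exp (-η * loss)` and normalises (`Measure.tilted`). -/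
def fgtsDist (K : ℕ) (η : ℝ) (prior : Measure Θ) (value : Θ → X → Fin N → ℝ)
    (adv : Adversary X N) : History N → Measure Θ
  | [] => prior
  | (S, o) :: h =>
    (fgtsDist K η prior value adv h).tilted fun θ =>
      -η * fgLoss K η S o (value θ (adv.context h)) (adv.reward h)

/-- The probability that, after the history `h`, the algorithm offers `S`: it samples `θ` from its
current distribution and offers the assortment that is optimal for the value function of `θ`. -/
def offerProb (K : ℕ) (η : ℝ) (prior : Measure Θ) (value : Θ → X → Fin N → ℝ)
    (adv : Adversary X N) (select : (Fin N → ℝ) → (Fin N → ℝ) → Finset (Fin N))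
    (h : History N) (S : Finset (Fin N)) : ℝ :=
  (fgtsDist K η prior value adv h).real
    {θ | select (value θ (adv.context h)) (adv.reward h) = S}

/-- The probability that the play of the first `h.length` rounds is `h`, when the algorithm faces
the adversary `adv` and customers purchase by the multinomial logit model with true value
function `fstar`. -/
def historyProb (K : ℕ) (η : ℝ) (prior : Measure Θ) (value : Θ → X → Fin N → ℝ)
    (fstar : X → Fin N → ℝ) (adv : Adversary X N)
    (select : (Fin N → ℝ) → (Fin N → ℝ) → Finset (Fin N)) : History N → ℝ
  | [] => 1
  | (S, o) :: h =>
    historyProb K η prior value fstar adv select h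
      * offerProb K η prior value adv select h S
      * mnlProb S (fstar (adv.context h)) o

/-- The regret accumulated along a history:
`∑_t (max_{S ∈ 𝒮} R(S, f⋆(x_t), r_t) - R(S_t, f⋆(x_t), r_t))`. -/
def cumRegret (K : ℕ) (fstar : X → Fin N → ℝ) (adv : Adversary X N) : History N → ℝ
  | [] => 0
  | (S, _) :: h =>
    cumRegret K fstar adv h
      + (bestReward K (fstar (adv.context h)) (adv.reward h)
        - expReward S (fstar (adv.context h)) (adv.reward h))

/-- The regret of Feel-Good Thompson Sampling over `T` rounds: the expectation of `cumRegret`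
over the (finitely many) plays of length `T`. -/
def regret (K : ℕ) (η : ℝ) (prior : Measure Θ) (value : Θ → X → Fin N → ℝ)
    (fstar : X → Fin N → ℝ) (adv : Adversary X N)
    (select : (Fin N → ℝ) → (Fin N → ℝ) → Finset (Fin N)) (T : ℕ) : ℝ :=
  ∑ ω : Fin T → Round N,
    historyProb K η prior value fstar adv select (List.ofFn ω)
      * cumRegret K fstar adv (List.ofFn ω)

end Algorithm

/-- The (log-)linear value function `f_{θ,i}(x) = exp(⟨θ, x_i⟩ - B)`, on a set of contexts
`x = (x_1, …, x_N)` with columns in `ℝ^d`. -/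
def linValue {d N : ℕ} (X : Set (Fin N → EuclideanSpace ℝ (Fin d))) (B : ℝ)
    (θ : EuclideanSpace ℝ (Fin d)) (x : X) (i : Fin N) : ℝ :=
  Real.exp (inner ℝ θ (x.1 i) - B)

end MNLBandit

end

/-!
The proof follows the likelihood ratio of a sampled value function to the true one. Write `v` for
the sampled and `w` for the true value vector of a round, `δ` for the difference of their choice
probabilities on the offered assortment, and `b` for the best reward.

*Drift.* One update multiplies the weight of `v` relative to `w` by `exp (logRatio …)`. Averaged
over the purchase, which follows `w`, the square loss contributes a downward drift of order
`‖δ‖² / K`, because its second moment is at most a constant times its mean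
(`moments_excessLoss`); the feel-good term contributes the optimism `η (b(v) - b(w))`. This is
`sum_mnlProb_mul_exp_logRatio_le`.

*Decoupling.* The regret of a round is `b(w) - b(v)` plus the error in the reward of the assortment
that is optimal for `v`, which is at most the sum of `|v i - w i|` over its items. The assortment
and `v` come from the same sample; an arithmetic-geometric inequality item by item, weighted by
the probability that the item is offered, replaces `v` by an independent sample
(`integral_indicator_abs_le`). This costs one term per item, hence `N` rather than the number of
assortments. The values are recovered from the choice probabilities with a loss of `K ^ 4`
(`sum_sq_sub_le`), so the drift absorbs the decoupled error, and what is left of a round is of order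
`η² K⁵ N` (`sum_offer_mul_regret_add_log_le`).

*Telescoping.* The logarithms of the normalising constants add up to a potential which is at least
the logarithm of the prior mass of a neighbourhood of the true value function, up to the
approximation error on it (`exp_mul_real_le_exp_logPotential`). Together these give
`regret_le_of_prior_mass`, and the learning rate balances `G / η` against `η K⁵ N T`, where
`exp (-G)` is the prior mass.

For a finite class the neighbourhood is the true function alone and `G = log n`; a class with one
function has `G = 0` and is treated separately, its regret being zero in every round. For the linear
class it is the copy of the parameter ball shrunk towards the true parameter by the factor
`min 1 (1 / (B T))`, whose relative volume is the `d`-th power of this factor.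
-/

namespace MNLBandit

/-! ### Multinomial logit choice probabilities and rewards -/

section Choice

variable {N : ℕ} {S : Finset (Fin N)} {v w r : Fin N → ℝ}

lemma one_le_one_add_sum (hv : ∀ i, v i ∈ Set.Icc (0 : ℝ) 1) (S : Finset (Fin N)) :
    1 ≤ 1 + ∑ j ∈ S, v j :=
  le_add_of_nonneg_right (Finset.sum_nonneg fun i _ => (hv i).1)

lemma mnlProb_some_of_mem {i : Fin N} (hi : i ∈ S) :
    mnlProb S v (some i) = v i / (1 + ∑ j ∈ S, v j) := by
  simp [mnlProb, hi]

lemma mnlProb_nonneg (hv : ∀ i, v i ∈ Set.Icc (0 : ℝ) 1) (S : Finset (Fin N))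
    (o : Option (Fin N)) : 0 ≤ mnlProb S v o := by
  have h := one_le_one_add_sum hv S
  cases o with
  | none => exact div_nonneg zero_le_one (by linarith)
  | some i =>
    simp only [mnlProb]
    split_ifs
    · exact div_nonneg (hv i).1 (by linarith)
    · exact le_rfl

/-- An expectation over the purchase decision is the no-purchase term plus a sum over the offered
items. -/
lemma sum_mnlProb_mul (S : Finset (Fin N)) (w : Fin N → ℝ) (F : Option (Fin N) → ℝ) :
    ∑ o, mnlProb S w o * F o
      = mnlProb S w none * F none + ∑ i ∈ S, mnlProb S w (some i) * F (some i) := by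
  rw [Fintype.sum_option]
  congr 1
  symm
  apply Finset.sum_subset (Finset.subset_univ S)
  intro i _ hi
  simp [mnlProb, hi]

lemma sum_mnlProb (hv : ∀ i, v i ∈ Set.Icc (0 : ℝ) 1) (S : Finset (Fin N)) :
    ∑ o, mnlProb S v o = 1 := by
  have h := one_le_one_add_sum hv S
  have := sum_mnlProb_mul S v fun _ => 1
  simp only [mul_one] at this
  rw [this, Finset.sum_congr rfl fun i hi => mnlProb_some_of_mem hi, ← Finset.sum_div]
  simp only [mnlProb]
  rw [← add_div, div_self (by linarith)]

lemma sum_mnlProb_some_le_one (hv : ∀ i, v i ∈ Set.Icc (0 : ℝ) 1) (S : Finset (Fin N)) :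
    ∑ i ∈ S, mnlProb S v (some i) ≤ 1 := by
  have h := sum_mnlProb_mul S v fun _ => 1
  simp only [mul_one, sum_mnlProb hv] at h
  linarith [mnlProb_nonneg hv S none]

lemma mnlProb_le_one (hv : ∀ i, v i ∈ Set.Icc (0 : ℝ) 1) (S : Finset (Fin N))
    (o : Option (Fin N)) : mnlProb S v o ≤ 1 := by
  rw [← sum_mnlProb hv S]
  exact Finset.single_le_sum (f := mnlProb S v) (fun o _ => mnlProb_nonneg hv S o)
    (Finset.mem_univ o)

lemma expReward_mem (hv : ∀ i, v i ∈ Set.Icc (0 : ℝ) 1) (hr : ∀ i, r i ∈ Set.Icc (0 : ℝ) 1)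
    (S : Finset (Fin N)) : expReward S v r ∈ Set.Icc (0 : ℝ) 1 := by
  refine ⟨Finset.sum_nonneg fun i _ => mul_nonneg (mnlProb_nonneg hv S _) (hr i).1, ?_⟩
  refine le_trans (Finset.sum_le_sum fun i _ => ?_) (sum_mnlProb_some_le_one hv S)
  exact mul_le_of_le_one_right (mnlProb_nonneg hv S _) (hr i).2

lemma expReward_le_bestReward {K : ℕ} (v r : Fin N → ℝ) (hS : S ∈ assortments N K) :
    expReward S v r ≤ bestReward K v r :=
  le_ciSup (f := fun S : {S : Finset (Fin N) // S ∈ assortments N K} => expReward S.1 v r)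
    (Set.finite_range _).bddAbove ⟨S, hS⟩

lemma nonempty_assortments {K : ℕ} (hK : 1 ≤ K) (hKN : K ≤ N) :
    Nonempty {S : Finset (Fin N) // S ∈ assortments N K} :=
  ⟨{⟨0, by omega⟩}, by simp [assortments, hK]⟩

lemma bestReward_le {K : ℕ} (hK : 1 ≤ K) (hKN : K ≤ N) {c : ℝ}
    (h : ∀ S ∈ assortments N K, expReward S v r ≤ c) : bestReward K v r ≤ c :=
  have := nonempty_assortments hK hKN
  ciSup_le fun S => h S.1 S.2

lemma bestReward_mem {K : ℕ} (hK : 1 ≤ K) (hKN : K ≤ N) (hv : ∀ i, v i ∈ Set.Icc (0 : ℝ) 1)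
    (hr : ∀ i, r i ∈ Set.Icc (0 : ℝ) 1) : bestReward K v r ∈ Set.Icc (0 : ℝ) 1 := by
  obtain ⟨S, hS⟩ := nonempty_assortments hK hKN
  exact ⟨(expReward_mem hv hr S).1.trans (expReward_le_bestReward v r hS),
    bestReward_le hK hKN fun S _ => (expReward_mem hv hr S).2⟩

lemma bestReward_eq_of_isArgmaxRule {K : ℕ} (hK : 1 ≤ K) (hKN : K ≤ N)
    {select : (Fin N → ℝ) → (Fin N → ℝ) → Finset (Fin N)} (hsel : IsArgmaxRule K select)
    (hv : ∀ i, v i ∈ Set.Icc (0 : ℝ) 1) (hr : ∀ i, r i ∈ Set.Icc (0 : ℝ) 1) :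
    bestReward K v r = expReward (select v r) v r :=
  le_antisymm (bestReward_le hK hKN (hsel v r hv hr).2)
    (expReward_le_bestReward v r (hsel v r hv hr).1)

/-- The change of a choice probability under a change of the values, with the normalisation of
only one of the two value vectors in a denominator. -/
lemma mnlProb_sub (hv : ∀ i, v i ∈ Set.Icc (0 : ℝ) 1) (hw : ∀ i, w i ∈ Set.Icc (0 : ℝ) 1)
    {i : Fin N} (hi : i ∈ S) :
    mnlProb S v (some i) - mnlProb S w (some i)
      = ((v i - w i) - mnlProb S w (some i) * ∑ j ∈ S, (v j - w j)) / (1 + ∑ j ∈ S, v j) := by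
  have h1 := one_le_one_add_sum hv S
  have h2 := one_le_one_add_sum hw S
  rw [mnlProb_some_of_mem hi, mnlProb_some_of_mem hi, Finset.sum_sub_distrib]
  field_simp
  ring

lemma expReward_sub_le (hv : ∀ i, v i ∈ Set.Icc (0 : ℝ) 1) (hw : ∀ i, w i ∈ Set.Icc (0 : ℝ) 1)
    (hr : ∀ i, r i ∈ Set.Icc (0 : ℝ) 1) (S : Finset (Fin N)) :
    expReward S v r - expReward S w r ≤ ∑ i ∈ S, |v i - w i| := by
  have h1 := one_le_one_add_sum hv S
  have hR := expReward_mem hw hr S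
  have key : expReward S v r - expReward S w r
      = (∑ i ∈ S, (v i - w i) * (r i - expReward S w r)) / (1 + ∑ j ∈ S, v j) := by
    have : expReward S v r - expReward S w r
        = ∑ i ∈ S, ((v i - w i) - mnlProb S w (some i) * ∑ j ∈ S, (v j - w j))
            / (1 + ∑ j ∈ S, v j) * r i := by
      simp only [expReward, ← Finset.sum_sub_distrib, ← sub_mul]
      exact Finset.sum_congr rfl fun i hi => by rw [← mnlProb_sub hv hw hi]
    rw [this]
    simp only [mul_sub, Finset.sum_sub_distrib (f := fun i => (v i - w i) * r i),
      ← Finset.sum_mul, div_mul_eq_mul_div, ← Finset.sum_div]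
    congr 1
    have hD : ∀ D : ℝ, ∑ i ∈ S, ((v i - w i) - mnlProb S w (some i) * D) * r i
        = ∑ i ∈ S, (v i - w i) * r i - D * expReward S w r := by
      intro D
      rw [expReward, Finset.mul_sum, ← Finset.sum_sub_distrib]
      exact Finset.sum_congr rfl fun i _ => by ring
    exact hD _
  rw [key]
  refine (div_le_div_of_nonneg_right (Finset.sum_le_sum (g := fun i => |v i - w i|) ?_)
    (by linarith)).trans (div_le_self (Finset.sum_nonneg fun i _ => abs_nonneg _) h1)
  intro i _
  refine (le_abs_self _).trans ?_
  rw [abs_mul]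
  refine mul_le_of_le_one_right (abs_nonneg _) ?_
  rw [abs_le]
  constructor <;> linarith [(hr i).1, (hr i).2, hR.1, hR.2]

lemma bestReward_sub_le {K : ℕ} (hK : 1 ≤ K) (hKN : K ≤ N) {ε : ℝ}
    (hv : ∀ i, v i ∈ Set.Icc (0 : ℝ) 1) (hw : ∀ i, w i ∈ Set.Icc (0 : ℝ) 1)
    (hr : ∀ i, r i ∈ Set.Icc (0 : ℝ) 1) (h : ∀ i, |v i - w i| ≤ ε) :
    bestReward K v r - bestReward K w r ≤ K * ε := by
  rw [sub_le_iff_le_add]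
  refine bestReward_le hK hKN fun S hS => ?_
  have h1 := expReward_sub_le hv hw hr S
  have h2 := expReward_le_bestReward w r hS
  have h3 : ∑ i ∈ S, |v i - w i| ≤ K * ε := by
    have hε : 0 ≤ ε := (abs_nonneg _).trans (h ⟨0, by omega⟩)
    refine (Finset.sum_le_card_nsmul S _ ε fun i _ => h i).trans ?_
    rw [nsmul_eq_mul]
    have : S.card ≤ K := (Finset.mem_filter.1 hS).2.2
    gcongr
  linarith

lemma sum_abs_mnlProb_sub_le (hv : ∀ i, v i ∈ Set.Icc (0 : ℝ) 1)
    (hw : ∀ i, w i ∈ Set.Icc (0 : ℝ) 1) (S : Finset (Fin N)) :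
    ∑ i ∈ S, |mnlProb S v (some i) - mnlProb S w (some i)| ≤ 2 * ∑ i ∈ S, |v i - w i| := by
  have h1 := one_le_one_add_sum hv S
  have hb : ∀ i ∈ S, |mnlProb S v (some i) - mnlProb S w (some i)|
      ≤ |v i - w i| + mnlProb S w (some i) * ∑ j ∈ S, |v j - w j| := by
    intro i hi
    rw [mnlProb_sub hv hw hi, abs_div, abs_of_nonneg (by linarith : 0 ≤ 1 + ∑ j ∈ S, v j)]
    refine (div_le_self (abs_nonneg _) h1).trans ((abs_sub _ _).trans ?_)
    rw [abs_mul, abs_of_nonneg (mnlProb_nonneg hw S _)]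
    gcongr
    · exact mnlProb_nonneg hw S _
    · exact Finset.abs_sum_le_sum_abs _ _
  refine (Finset.sum_le_sum hb).trans ?_
  rw [Finset.sum_add_distrib, ← Finset.sum_mul]
  have := mul_le_mul_of_nonneg_right (sum_mnlProb_some_le_one hw S)
    (Finset.sum_nonneg fun i (_ : i ∈ S) => abs_nonneg (v i - w i))
  linarith

/-- The choice probabilities determine the values: since `v i = μ_i / μ_0` and `μ_0 ≥ 1 / (K + 1)`,
the inverse of `v ↦ μ` is Lipschitz with a constant polynomial in `K`. -/
lemma sum_sq_sub_le {K : ℕ} (hK : 1 ≤ K) (hS : S.card ≤ K)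
    (hv : ∀ i, v i ∈ Set.Icc (0 : ℝ) 1) (hw : ∀ i, w i ∈ Set.Icc (0 : ℝ) 1) :
    ∑ i ∈ S, (v i - w i) ^ 2
      ≤ 16 * K ^ 4 * ∑ i ∈ S, (mnlProb S v (some i) - mnlProb S w (some i)) ^ 2 := by
  set δ : Fin N → ℝ := fun i => mnlProb S v (some i) - mnlProb S w (some i) with hδ
  set s := ∑ i ∈ S, δ i ^ 2 with hs
  have hs0 : 0 ≤ s := Finset.sum_nonneg fun i _ => sq_nonneg _
  have hK' : (1 : ℝ) ≤ K := by exact_mod_cast hK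
  have hc : (S.card : ℝ) ≤ K := by exact_mod_cast hS
  have h1 := one_le_one_add_sum hv S
  have h2 := one_le_one_add_sum hw S
  have hVK : 1 + ∑ j ∈ S, v j ≤ 2 * K := by
    have := Finset.sum_le_card_nsmul S v 1 fun i _ => (hv i).2
    rw [nsmul_eq_mul, mul_one] at this
    linarith
  have hcs : (∑ i ∈ S, δ i) ^ 2 ≤ K * s :=
    sq_sum_le_card_mul_sum_sq.trans (mul_le_mul_of_nonneg_right hc hs0)
  have hid : ∀ i ∈ S, v i - w i = (1 + ∑ j ∈ S, v j) * (δ i + w i * ∑ j ∈ S, δ j) := by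
    intro i hi
    have hsum : ∑ j ∈ S, δ j
        = (∑ j ∈ S, v j) / (1 + ∑ j ∈ S, v j) - (∑ j ∈ S, w j) / (1 + ∑ j ∈ S, w j) := by
      simp only [hδ, Finset.sum_sub_distrib, Finset.sum_div]
      congr 1 <;> exact Finset.sum_congr rfl fun j hj => mnlProb_some_of_mem hj
    rw [hsum]
    simp only [hδ, mnlProb_some_of_mem hi]
    field_simp
    ring
  have hb : ∀ i ∈ S, (v i - w i) ^ 2 ≤ 8 * K ^ 2 * (δ i ^ 2 + K * s) := by
    intro i hi
    have hw2 : w i ^ 2 ≤ 1 := pow_le_one₀ (hw i).1 (hw i).2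
    have hin : (δ i + w i * ∑ j ∈ S, δ j) ^ 2 ≤ 2 * (δ i ^ 2 + K * s) := by
      have := add_sq_le (a := δ i) (b := w i * ∑ j ∈ S, δ j)
      have h3 : (w i * ∑ j ∈ S, δ j) ^ 2 ≤ K * s := by
        rw [mul_pow]
        exact (mul_le_of_le_one_left (sq_nonneg _) hw2).trans hcs
      linarith
    rw [hid i hi, mul_pow]
    calc _ ≤ (2 * (K : ℝ)) ^ 2 * (2 * (δ i ^ 2 + K * s)) := by gcongr
      _ = _ := by ring
  refine (Finset.sum_le_sum hb).trans ?_
  rw [← Finset.mul_sum, Finset.sum_add_distrib, Finset.sum_const, nsmul_eq_mul, ← hs]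
  have h4 : s + S.card * (K * s) ≤ 2 * K ^ 2 * s := by
    have h5 : S.card * (K * s) ≤ K * (K * s) := by gcongr
    have h6 : 1 * s ≤ K ^ 2 * s := by
      gcongr
      exact one_le_pow₀ hK'
    nlinarith
  calc 8 * (K : ℝ) ^ 2 * (s + S.card * (K * s)) ≤ 8 * K ^ 2 * (2 * K ^ 2 * s) := by gcongr
    _ = _ := by ring

end Choice

/-! ### The one-round update and its exponential moment -/

section Loss

variable {N : ℕ} {S : Finset (Fin N)} {v w r : Fin N → ℝ}

/-- The logarithm of the factor by which one update changes the weight of the value vector `v`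
relative to that of `w`. -/
noncomputable def logRatio (K : ℕ) (η : ℝ) (S : Finset (Fin N)) (o : Option (Fin N))
    (v w r : Fin N → ℝ) : ℝ :=
  -η * fgLoss K η S o v r - -η * fgLoss K η S o w r

/-- The excess square loss of `v` over `w` on the purchase indicators. -/
noncomputable def excessLoss (S : Finset (Fin N)) (o : Option (Fin N)) (v w : Fin N → ℝ) : ℝ :=
  ∑ i ∈ S, (mnlProb S v (some i) - if o = some i then 1 else 0) ^ 2
    - ∑ i ∈ S, (mnlProb S w (some i) - if o = some i then 1 else 0) ^ 2

lemma logRatio_eq {K : ℕ} (hK : 1 ≤ K) {η : ℝ} (hη : 0 < η) (S : Finset (Fin N))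
    (o : Option (Fin N)) (v w r : Fin N → ℝ) :
    logRatio K η S o v w r
      = -(excessLoss S o v w / (8 * K)) + η * (bestReward K v r - bestReward K w r) := by
  have hK' : (0 : ℝ) < K := by exact_mod_cast hK
  simp only [logRatio, fgLoss, excessLoss]
  field_simp
  ring

lemma sum_sq_sub_indicator_le (hv : ∀ i, v i ∈ Set.Icc (0 : ℝ) 1) (S : Finset (Fin N))
    (o : Option (Fin N)) :
    ∑ i ∈ S, (mnlProb S v (some i) - if o = some i then 1 else 0) ^ 2 ≤ 2 := by
  have h1 : ∀ i ∈ S, (mnlProb S v (some i) - if o = some i then (1 : ℝ) else 0) ^ 2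
      ≤ mnlProb S v (some i) + if o = some i then 1 else 0 := by
    intro i _
    have h0 := mnlProb_nonneg hv S (some i)
    have h1 := mnlProb_le_one hv S (some i)
    split_ifs <;> nlinarith
  have h2 : ∑ i ∈ S, (if o = some i then (1 : ℝ) else 0) ≤ 1 := by
    cases o with
    | none => simp
    | some j =>
      simp only [Option.some.injEq, Finset.sum_ite_eq]
      split_ifs <;> norm_num
  refine (Finset.sum_le_sum h1).trans ?_
  rw [Finset.sum_add_distrib]
  linarith [sum_mnlProb_some_le_one hv S]

lemma abs_excessLoss_le (hv : ∀ i, v i ∈ Set.Icc (0 : ℝ) 1) (hw : ∀ i, w i ∈ Set.Icc (0 : ℝ) 1)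
    (S : Finset (Fin N)) (o : Option (Fin N)) : |excessLoss S o v w| ≤ 2 :=
  abs_sub_le_of_nonneg_of_le (Finset.sum_nonneg fun _ _ => sq_nonneg _)
    (sum_sq_sub_indicator_le hv S o) (Finset.sum_nonneg fun _ _ => sq_nonneg _)
    (sum_sq_sub_indicator_le hw S o)

lemma excessLoss_le (hv : ∀ i, v i ∈ Set.Icc (0 : ℝ) 1) (hw : ∀ i, w i ∈ Set.Icc (0 : ℝ) 1)
    (S : Finset (Fin N)) (o : Option (Fin N)) :
    excessLoss S o v w ≤ 4 * ∑ i ∈ S, |v i - w i| := by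
  have h := sum_abs_mnlProb_sub_le hv hw S
  have : excessLoss S o v w
      ≤ ∑ i ∈ S, 2 * |mnlProb S v (some i) - mnlProb S w (some i)| := by
    rw [excessLoss, ← Finset.sum_sub_distrib]
    refine Finset.sum_le_sum fun i _ => ?_
    have hv0 := mnlProb_nonneg hv S (some i)
    have hv1 := mnlProb_le_one hv S (some i)
    have hw0 := mnlProb_nonneg hw S (some i)
    have hw1 := mnlProb_le_one hw S (some i)
    rw [sq_sub_sq, mul_comm]
    refine (le_abs_self _).trans ?_
    rw [abs_mul, mul_comm, sub_sub_sub_cancel_right]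
    refine mul_le_mul_of_nonneg_right ?_ (abs_nonneg _)
    rw [abs_le]
    constructor <;> split_ifs <;> linarith
  rw [← Finset.mul_sum] at this
  linarith

lemma abs_logRatio_le {K : ℕ} (hK : 1 ≤ K) (hKN : K ≤ N) {η : ℝ} (hη : 0 < η)
    (hv : ∀ i, v i ∈ Set.Icc (0 : ℝ) 1) (hw : ∀ i, w i ∈ Set.Icc (0 : ℝ) 1)
    (hr : ∀ i, r i ∈ Set.Icc (0 : ℝ) 1) (S : Finset (Fin N)) (o : Option (Fin N)) :
    |logRatio K η S o v w r| ≤ 1 / 4 + η := by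
  have hK' : (1 : ℝ) ≤ K := by exact_mod_cast hK
  have h1 := abs_excessLoss_le hv hw S o
  have h2 : |bestReward K v r - bestReward K w r| ≤ 1 :=
    abs_sub_le_of_nonneg_of_le (bestReward_mem hK hKN hv hr).1 (bestReward_mem hK hKN hv hr).2
      (bestReward_mem hK hKN hw hr).1 (bestReward_mem hK hKN hw hr).2
  rw [logRatio_eq hK hη]
  refine (abs_add_le _ _).trans (add_le_add ?_ ?_)
  · rw [abs_neg, abs_div, abs_of_pos (by positivity : (0 : ℝ) < 8 * K), div_le_iff₀ (by positivity)]
    linarith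
  · rw [abs_mul, abs_of_pos hη]
    exact mul_le_of_le_one_right hη.le h2

lemma neg_le_logRatio {K : ℕ} (hK : 1 ≤ K) (hKN : K ≤ N) {η ε : ℝ} (hη : 0 < η)
    (hv : ∀ i, v i ∈ Set.Icc (0 : ℝ) 1) (hw : ∀ i, w i ∈ Set.Icc (0 : ℝ) 1)
    (hr : ∀ i, r i ∈ Set.Icc (0 : ℝ) 1) (hS : S.card ≤ K) (o : Option (Fin N))
    (h : ∀ i, |v i - w i| ≤ ε) :
    -(ε / 2 + η * K * ε) ≤ logRatio K η S o v w r := by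
  have hK' : (0 : ℝ) < K := by exact_mod_cast hK
  have hε : 0 ≤ ε := (abs_nonneg _).trans (h ⟨0, by omega⟩)
  have h1 : excessLoss S o v w / (8 * K) ≤ ε / 2 := by
    have h2 : ∑ i ∈ S, |v i - w i| ≤ K * ε := by
      refine (Finset.sum_le_card_nsmul S _ ε fun i _ => h i).trans ?_
      rw [nsmul_eq_mul]
      gcongr
    rw [div_le_iff₀ (by positivity)]
    linarith [excessLoss_le hv hw S o]
  have h2 := bestReward_sub_le hK hKN hw hv hr fun i => (abs_sub_comm _ _).trans_le (h i)
  have h3 := mul_le_mul_of_nonneg_left h2 hη.le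
  rw [logRatio_eq hK hη]
  linarith

/-- The first two moments of the excess loss when the purchase follows the model with values `w`:
the mean is the squared distance of the choice probabilities, and the second moment is at most a
constant times the mean. -/
lemma moments_excessLoss (hv : ∀ i, v i ∈ Set.Icc (0 : ℝ) 1)
    (hw : ∀ i, w i ∈ Set.Icc (0 : ℝ) 1) (S : Finset (Fin N)) :
    ∑ o, mnlProb S w o * excessLoss S o v w
        = ∑ i ∈ S, (mnlProb S v (some i) - mnlProb S w (some i)) ^ 2 ∧
      ∑ o, mnlProb S w o * excessLoss S o v w ^ 2
        ≤ 6 * ∑ i ∈ S, (mnlProb S v (some i) - mnlProb S w (some i)) ^ 2 := by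
  set δ : Fin N → ℝ := fun i => mnlProb S v (some i) - mnlProb S w (some i) with hδ
  set s := ∑ i ∈ S, δ i ^ 2 with hs
  set m := ∑ i ∈ S, mnlProb S w (some i) * δ i with hm
  set g : Option (Fin N) → ℝ := fun o => ∑ i ∈ S, δ i * if o = some i then 1 else 0 with hg
  have hexc : ∀ o, excessLoss S o v w = s + 2 * (m - g o) := by
    intro o
    rw [excessLoss, hs, hm, hg, ← Finset.sum_sub_distrib, ← Finset.sum_sub_distrib,
      Finset.mul_sum, ← Finset.sum_add_distrib]
    refine Finset.sum_congr rfl fun i _ => ?_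
    simp only [hδ]
    ring
  have hg0 : g none = 0 := by simp [hg]
  have hg1 : ∀ i ∈ S, g (some i) = δ i := by
    intro i hi
    simp [hg, hi]
  have h1 : ∑ o, mnlProb S w o = 1 := sum_mnlProb hw S
  have hEg : ∑ o, mnlProb S w o * g o = m := by
    rw [sum_mnlProb_mul, hg0, mul_zero, zero_add]
    exact Finset.sum_congr rfl fun i hi => by rw [hg1 i hi]
  have hEg2 : ∑ o, mnlProb S w o * g o ^ 2 ≤ s := by
    rw [sum_mnlProb_mul, hg0]
    simp only [ne_eq, OfNat.ofNat_ne_zero, not_false_eq_true, zero_pow, mul_zero, zero_add]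
    refine Finset.sum_le_sum fun i hi => ?_
    rw [hg1 i hi]
    exact mul_le_of_le_one_left (sq_nonneg _) (mnlProb_le_one hw S _)
  have hs0 : 0 ≤ s := Finset.sum_nonneg fun i _ => sq_nonneg _
  have hs2 : s ≤ 2 := by
    refine (Finset.sum_le_sum (g := fun i => mnlProb S v (some i) + mnlProb S w (some i))
      fun i _ => ?_).trans ?_
    · have hv0 := mnlProb_nonneg hv S (some i)
      have hv1 := mnlProb_le_one hv S (some i)
      have hw0 := mnlProb_nonneg hw S (some i)
      have hw1 := mnlProb_le_one hw S (some i)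
      simp only [hδ]
      nlinarith
    · rw [Finset.sum_add_distrib]
      linarith [sum_mnlProb_some_le_one hv S, sum_mnlProb_some_le_one hw S]
  constructor
  · have : ∀ o, mnlProb S w o * excessLoss S o v w
        = (s + 2 * m) * mnlProb S w o - 2 * (mnlProb S w o * g o) := by
      intro o
      rw [hexc]
      ring
    simp only [this, Finset.sum_sub_distrib, ← Finset.mul_sum, h1, hEg]
    ring
  · have : ∀ o, mnlProb S w o * excessLoss S o v w ^ 2
        = (s + 2 * m) ^ 2 * mnlProb S w o - 4 * (s + 2 * m) * (mnlProb S w o * g o)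
          + 4 * (mnlProb S w o * g o ^ 2) := by
      intro o
      rw [hexc]
      ring
    simp only [this, Finset.sum_sub_distrib, Finset.sum_add_distrib, ← Finset.mul_sum, h1, hEg]
    nlinarith [sq_nonneg m]

/-- The exponential moment of the update: on average over the purchase, the weight of `v` relative
to that of the true value vector `w` drifts upwards by the optimism of `v` and downwards by the
squared distance of the choice probabilities. -/
lemma sum_mnlProb_mul_exp_logRatio_le {K : ℕ} (hK : 1 ≤ K) (hKN : K ≤ N) {η : ℝ} (hη : 0 < η)
    (hη' : η ≤ 3 / 4) (hv : ∀ i, v i ∈ Set.Icc (0 : ℝ) 1) (hw : ∀ i, w i ∈ Set.Icc (0 : ℝ) 1)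
    (hr : ∀ i, r i ∈ Set.Icc (0 : ℝ) 1) (S : Finset (Fin N)) :
    ∑ o, mnlProb S w o * (Real.exp (logRatio K η S o v w r) - 1)
      ≤ η * (bestReward K v r - bestReward K w r)
        - (∑ i ∈ S, (mnlProb S v (some i) - mnlProb S w (some i)) ^ 2) / (48 * K)
        + 10 * η ^ 2 := by
  obtain ⟨hE, hE2⟩ := moments_excessLoss hv hw S
  set s := ∑ i ∈ S, (mnlProb S v (some i) - mnlProb S w (some i)) ^ 2 with hs
  set b := bestReward K v r - bestReward K w r with hb
  have hs0 : 0 ≤ s := Finset.sum_nonneg fun i _ => sq_nonneg _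
  have hK' : (1 : ℝ) ≤ K := by exact_mod_cast hK
  have hb1 : b ^ 2 ≤ 1 := by
    rw [sq_le_one_iff_abs_le_one]
    exact abs_sub_le_of_nonneg_of_le (bestReward_mem hK hKN hv hr).1
      (bestReward_mem hK hKN hv hr).2 (bestReward_mem hK hKN hw hr).1
      (bestReward_mem hK hKN hw hr).2
  have hexp : ∀ o, Real.exp (logRatio K η S o v w r) - 1
      ≤ η * b + 10 * η ^ 2 - excessLoss S o v w / (8 * K)
        + 10 / 9 * excessLoss S o v w ^ 2 / (64 * K) := by
    intro o
    have h1 := (abs_le.1 (Real.abs_exp_sub_one_sub_id_le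
      ((abs_logRatio_le hK hKN hη hv hw hr S o).trans (by linarith)))).2
    rw [logRatio_eq hK hη, ← hb] at h1 ⊢
    set D := excessLoss S o v w / (8 * K) with hD
    have hDD : D ^ 2 ≤ excessLoss S o v w ^ 2 / (64 * K) := by
      rw [hD, div_pow, mul_pow]
      refine div_le_div_of_nonneg_left (sq_nonneg _) (by positivity) ?_
      nlinarith
    -- the cross term is split so that the share of `D ^ 2` stays below the first-order gain
    have h2 : (-D + η * b) ^ 2 ≤ 10 / 9 * D ^ 2 + 10 * (η * b) ^ 2 := by
      nlinarith [sq_nonneg (D + 9 * (η * b))]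
    have h3 : (η * b) ^ 2 ≤ η ^ 2 := by
      rw [mul_pow]
      exact mul_le_of_le_one_right (sq_nonneg _) hb1
    have h4 : 10 / 9 * excessLoss S o v w ^ 2 / (64 * K)
        = 10 / 9 * (excessLoss S o v w ^ 2 / (64 * K)) := by ring
    rw [h4]
    linarith
  calc ∑ o, mnlProb S w o * (Real.exp (logRatio K η S o v w r) - 1)
      ≤ ∑ o, ((η * b + 10 * η ^ 2) * mnlProb S w o
          - (mnlProb S w o * excessLoss S o v w) / (8 * K)
          + 10 / 9 / (64 * K) * (mnlProb S w o * excessLoss S o v w ^ 2)) := by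
        refine Finset.sum_le_sum fun o _ => ?_
        refine (mul_le_mul_of_nonneg_left (hexp o) (mnlProb_nonneg hw S o)).trans_eq ?_
        ring
    _ ≤ η * b + 10 * η ^ 2 - s / (8 * K) + 10 / 9 / (64 * K) * (6 * s) := by
        rw [Finset.sum_add_distrib, Finset.sum_sub_distrib, ← Finset.mul_sum, ← Finset.mul_sum,
          ← Finset.sum_div, sum_mnlProb hw, hE, mul_one]
        gcongr
    _ = _ := by
        field_simp
        ring

end Loss

/-! ### Sampling: decoupling and the one-round inequality -/

section Sampling

variable {Θ : Type} [MeasurableSpace Θ] {p : Measure Θ} {N : ℕ} {V : Θ → Fin N → ℝ}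
  {w r : Fin N → ℝ}

lemma measurable_mnlProb (hVm : ∀ i, Measurable fun θ => V θ i) (S : Finset (Fin N))
    (o : Option (Fin N)) : Measurable fun θ => mnlProb S (V θ) o := by
  cases o with
  | none =>
    simp only [mnlProb]
    fun_prop
  | some i =>
    simp only [mnlProb]
    split_ifs <;> fun_prop

lemma measurable_bestReward (K : ℕ) (hVm : ∀ i, Measurable fun θ => V θ i) (r : Fin N → ℝ) :
    Measurable fun θ => bestReward K (V θ) r := by
  refine Measurable.iSup fun S => ?_
  simp only [expReward]
  exact Finset.measurable_sum _ fun i _ => (measurable_mnlProb hVm _ _).mul_const _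

lemma measurable_fgLoss (K : ℕ) (η : ℝ) (hVm : ∀ i, Measurable fun θ => V θ i)
    (S : Finset (Fin N)) (o : Option (Fin N)) (r : Fin N → ℝ) :
    Measurable fun θ => fgLoss K η S o (V θ) r := by
  simp only [fgLoss]
  refine Measurable.sub (Measurable.const_mul (Finset.measurable_sum _ fun i _ => ?_) _)
    (measurable_bestReward K hVm r)
  exact ((measurable_mnlProb hVm _ _).sub_const _).pow_const _

lemma measurable_logRatio (K : ℕ) (η : ℝ) (hVm : ∀ i, Measurable fun θ => V θ i)
    (S : Finset (Fin N)) (o : Option (Fin N)) (w r : Fin N → ℝ) :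
    Measurable fun θ => logRatio K η S o (V θ) w r := by
  simp only [logRatio]
  exact ((measurable_fgLoss K η hVm S o r).const_mul _).sub_const _

lemma integrable_of_ae_mem_Icc [IsFiniteMeasure p] {g : Θ → ℝ} {a b : ℝ} (hg : Measurable g)
    (h : ∀ᵐ θ ∂p, g θ ∈ Set.Icc a b) : Integrable g p :=
  Integrable.of_mem_Icc a b hg.aemeasurable h

lemma integrable_bestReward [IsFiniteMeasure p] {K : ℕ} (hK : 1 ≤ K) (hKN : K ≤ N)
    (hVm : ∀ i, Measurable fun θ => V θ i) (hV : ∀ᵐ θ ∂p, ∀ i, V θ i ∈ Set.Icc (0 : ℝ) 1)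
    (hr : ∀ i, r i ∈ Set.Icc (0 : ℝ) 1) : Integrable (fun θ => bestReward K (V θ) r) p :=
  integrable_of_ae_mem_Icc (measurable_bestReward K hVm r)
    (hV.mono fun _ h => bestReward_mem hK hKN h hr)

lemma integrable_sq_sub [IsFiniteMeasure p] (hVm : ∀ i, Measurable fun θ => V θ i)
    (hV : ∀ᵐ θ ∂p, ∀ i, V θ i ∈ Set.Icc (0 : ℝ) 1) (hw : ∀ i, w i ∈ Set.Icc (0 : ℝ) 1)
    (i : Fin N) : Integrable (fun θ => (V θ i - w i) ^ 2) p :=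
  integrable_of_ae_mem_Icc (a := 0) (b := 1) (((hVm i).sub_const _).pow_const _)
    (hV.mono fun θ h => ⟨sq_nonneg _, by
      rw [sq_le_one_iff_abs_le_one]
      exact abs_sub_le_of_nonneg_of_le (h i).1 (h i).2 (hw i).1 (hw i).2⟩)

lemma integrable_exp_logRatio [IsFiniteMeasure p] {K : ℕ} {η : ℝ} (hK : 1 ≤ K) (hKN : K ≤ N)
    (hη : 0 < η) (hVm : ∀ i, Measurable fun θ => V θ i)
    (hV : ∀ᵐ θ ∂p, ∀ i, V θ i ∈ Set.Icc (0 : ℝ) 1) (hw : ∀ i, w i ∈ Set.Icc (0 : ℝ) 1)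
    (hr : ∀ i, r i ∈ Set.Icc (0 : ℝ) 1) (S : Finset (Fin N)) (o : Option (Fin N)) :
    Integrable (fun θ => Real.exp (logRatio K η S o (V θ) w r)) p :=
  integrable_of_ae_mem_Icc (a := 0) (b := Real.exp (1 / 4 + η))
    (measurable_logRatio K η hVm S o w r).exp
    (hV.mono fun _ h => ⟨(Real.exp_pos _).le, Real.exp_le_exp.2
      ((le_abs_self _).trans (abs_logRatio_le hK hKN hη h hw hr S o))⟩)

lemma integral_comp_finset [IsFiniteMeasure p] {sel : Θ → Finset (Fin N)}
    (hsel : ∀ S, MeasurableSet {θ | sel θ = S}) (c : Finset (Fin N) → ℝ) :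
    ∫ θ, c (sel θ) ∂p = ∑ S, p.real {θ | sel θ = S} * c S := by
  have h1 : ∀ θ, c (sel θ) = ∑ S, {θ | sel θ = S}.indicator (fun _ => c S) θ := by
    intro θ
    simp [Set.indicator_apply]
  simp only [h1]
  rw [integral_finsetSum _ fun S _ => (integrable_const (c S)).indicator (hsel S)]
  refine Finset.sum_congr rfl fun S _ => ?_
  rw [integral_indicator_const _ (hsel S), smul_eq_mul]

/-- Decoupling of an event and a function of the same sample: the cost of replacing the sample in
`g` by an independent copy is `1 / (4 * l)`. -/
lemma integral_indicator_abs_le [IsProbabilityMeasure p] {A : Set Θ} (hA : MeasurableSet A)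
    {g : Θ → ℝ} (hg : Integrable g p) (hg2 : Integrable (fun θ => g θ ^ 2) p) {l : ℝ}
    (hl : 0 < l) :
    ∫ θ, A.indicator (fun θ => |g θ|) θ ∂p ≤ 1 / (4 * l) + l * (p.real A * ∫ θ, g θ ^ 2 ∂p) := by
  rcases (measureReal_nonneg (μ := p) (s := A)).eq_or_lt with h0 | h0
  · rw [integral_indicator hA, setIntegral_measure_zero _
      ((measureReal_eq_zero_iff (measure_ne_top p A)).1 h0.symm), ← h0]
    simp only [zero_mul, mul_zero, add_zero]
    positivity
  · set Q := p.real A with hQ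
    -- the arithmetic-geometric inequality with weight `Q`
    have hpt : ∀ θ, A.indicator (fun θ => |g θ|) θ
        ≤ A.indicator (fun _ => 1 / (4 * l * Q)) θ + l * Q * g θ ^ 2 := by
      intro θ
      by_cases hθ : θ ∈ A
      · simp only [Set.indicator_of_mem hθ]
        have h1 : 0 < 4 * l * Q := by positivity
        have h2 : |g θ| * (4 * l * Q) ≤ 1 + l * Q * g θ ^ 2 * (4 * l * Q) := by
          rw [← sq_abs (g θ)]
          nlinarith [sq_nonneg (2 * l * Q * |g θ| - 1)]
        rw [← sub_le_iff_le_add, le_div_iff₀ h1]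
        linarith
      · simp only [Set.indicator_of_notMem hθ, zero_add]
        positivity
    have hi1 : Integrable (A.indicator fun _ => 1 / (4 * l * Q)) p :=
      (integrable_const _).indicator hA
    have hi2 : Integrable (fun θ => l * Q * g θ ^ 2) p := hg2.const_mul _
    refine (integral_mono (hg.abs.indicator hA) (hi1.add hi2) hpt).trans_eq ?_
    simp only [Pi.add_apply]
    rw [integral_add hi1 hi2, integral_indicator_const _ hA, integral_const_mul, smul_eq_mul,
      ← hQ]
    field_simp

/-- On average over the sample, the regret of the optimal assortment of the sampled values is at
most the negative optimism of the sample plus the squared error of an independent sample on the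
offered items. -/
lemma sum_real_mul_regret_le [IsProbabilityMeasure p] {K : ℕ} (hK : 1 ≤ K) (hKN : K ≤ N)
    (hVm : ∀ i, Measurable fun θ => V θ i)
    (hV : ∀ᵐ θ ∂p, ∀ i, V θ i ∈ Set.Icc (0 : ℝ) 1) (hw : ∀ i, w i ∈ Set.Icc (0 : ℝ) 1)
    (hr : ∀ i, r i ∈ Set.Icc (0 : ℝ) 1) {select : (Fin N → ℝ) → (Fin N → ℝ) → Finset (Fin N)}
    (hsel : IsArgmaxRule K select) (hselm : ∀ S, MeasurableSet {θ | select (V θ) r = S})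
    {l : ℝ} (hl : 0 < l) :
    ∑ S, p.real {θ | select (V θ) r = S} * (bestReward K w r - expReward S w r)
      ≤ bestReward K w r - ∫ θ, bestReward K (V θ) r ∂p + N / (4 * l)
        + l * ∑ S, p.real {θ | select (V θ) r = S} * ∑ i ∈ S, ∫ θ, (V θ i - w i) ^ 2 ∂p := by
  have hib := integrable_bestReward hK hKN hVm hV hr
  have hid : ∀ i, Integrable (fun θ => V θ i - w i) p := fun i =>
    (integrable_of_ae_mem_Icc (hVm i) (hV.mono fun θ h => h i)).sub (integrable_const _)
  have hid2 := integrable_sq_sub hVm hV hw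
  have hAm : ∀ i, MeasurableSet {θ | i ∈ select (V θ) r} := by
    intro i
    have : {θ | i ∈ select (V θ) r}
        = ⋃ S ∈ {S : Finset (Fin N) | i ∈ S}, {θ | select (V θ) r = S} := by
      ext θ
      simp
    rw [this]
    exact MeasurableSet.biUnion (Set.to_countable _) fun S _ => hselm S
  have hA : ∀ i, p.real {θ | i ∈ select (V θ) r}
      = ∑ S, p.real {θ | select (V θ) r = S} * if i ∈ S then 1 else 0 := by
    intro i
    rw [← integral_comp_finset hselm fun S => if i ∈ S then (1 : ℝ) else 0,
      ← integral_indicator_one (hAm i)]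
    exact integral_congr_ae (.of_forall fun θ => by simp [Set.indicator_apply])
  have hsum : ∑ i, p.real {θ | i ∈ select (V θ) r} * ∫ θ, (V θ i - w i) ^ 2 ∂p
      = ∑ S, p.real {θ | select (V θ) r = S} * ∑ i ∈ S, ∫ θ, (V θ i - w i) ^ 2 ∂p := by
    simp only [hA, Finset.sum_mul]
    rw [Finset.sum_comm]
    refine Finset.sum_congr rfl fun S _ => ?_
    rw [Finset.mul_sum, ← Finset.sum_subset (Finset.subset_univ S)]
    · exact Finset.sum_congr rfl fun i hi => by simp [hi]
    · intro i _ hi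
      simp [hi]
  rw [← integral_comp_finset hselm fun S => bestReward K w r - expReward S w r]
  have hind : ∀ i, Integrable
      ({θ | i ∈ select (V θ) r}.indicator fun θ => |V θ i - w i|) p :=
    fun i => (hid i).abs.indicator (hAm i)
  have hpt : ∀ᵐ θ ∂p, bestReward K w r - expReward (select (V θ) r) w r
      ≤ (bestReward K w r - bestReward K (V θ) r)
        + ∑ i, {θ | i ∈ select (V θ) r}.indicator (fun θ => |V θ i - w i|) θ := by
    filter_upwards [hV] with θ hθ
    have h1 := bestReward_eq_of_isArgmaxRule hK hKN hsel hθ hr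
    have h2 := expReward_sub_le hθ hw hr (select (V θ) r)
    have h3 : ∑ i, {θ | i ∈ select (V θ) r}.indicator (fun θ => |V θ i - w i|) θ
        = ∑ i ∈ select (V θ) r, |V θ i - w i| := by
      simp [Set.indicator_apply]
    rw [h3]
    linarith
  have hi0 : Integrable (fun θ => bestReward K w r - expReward (select (V θ) r) w r) p := by
    have : ∀ θ, bestReward K w r - expReward (select (V θ) r) w r
        = ∑ S, {θ | select (V θ) r = S}.indicator
            (fun _ => bestReward K w r - expReward S w r) θ := by
      intro θ
      simp [Set.indicator_apply]
    simp only [this]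
    exact integrable_finsetSum _ fun S _ => (integrable_const _).indicator (hselm S)
  have hi1 : Integrable (fun θ => bestReward K w r - bestReward K (V θ) r) p :=
    (integrable_const _).sub hib
  have hi2 : Integrable (fun θ =>
      ∑ i, {θ | i ∈ select (V θ) r}.indicator (fun θ => |V θ i - w i|) θ) p :=
    integrable_finsetSum _ fun i _ => hind i
  refine (integral_mono_ae hi0 (hi1.add hi2) hpt).trans ?_
  simp only [Pi.add_apply]
  rw [integral_add hi1 hi2, integral_sub (integrable_const _) hib,
    integral_finsetSum _ fun i _ => hind i]
  have hdec := Finset.sum_le_sum fun i (_ : i ∈ Finset.univ) =>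
    integral_indicator_abs_le (hAm i) (hid i) (hid2 i) hl
  rw [Finset.sum_add_distrib, ← Finset.mul_sum, hsum] at hdec
  simp only [integral_const, probReal_univ, smul_eq_mul, one_mul, Finset.sum_const,
    Finset.card_univ, Fintype.card_fin, nsmul_eq_mul] at hdec ⊢
  rw [mul_one_div] at hdec
  linarith

/-- The expected logarithm of the normalising constant of the update, for a fixed assortment. -/
lemma sum_mnlProb_mul_log_integral_le [IsProbabilityMeasure p] {K : ℕ} (hK : 1 ≤ K)
    (hKN : K ≤ N) {η : ℝ} (hη : 0 < η) (hη' : η ≤ 3 / 4) (hVm : ∀ i, Measurable fun θ => V θ i)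
    (hV : ∀ᵐ θ ∂p, ∀ i, V θ i ∈ Set.Icc (0 : ℝ) 1) (hw : ∀ i, w i ∈ Set.Icc (0 : ℝ) 1)
    (hr : ∀ i, r i ∈ Set.Icc (0 : ℝ) 1) {S : Finset (Fin N)} (hS : S.card ≤ K) :
    ∑ o, mnlProb S w o * Real.log (∫ θ, Real.exp (logRatio K η S o (V θ) w r) ∂p)
      ≤ η * (∫ θ, bestReward K (V θ) r ∂p - bestReward K w r)
        - (∑ i ∈ S, ∫ θ, (V θ i - w i) ^ 2 ∂p) / (768 * K ^ 5) + 10 * η ^ 2 := by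
  have hK' : (1 : ℝ) ≤ K := by exact_mod_cast hK
  have hib := integrable_bestReward hK hKN hVm hV hr
  have hid2 := integrable_sq_sub hVm hV hw
  have hie := integrable_exp_logRatio hK hKN hη hVm hV hw hr S
  have hi1 : Integrable (fun θ => η * (bestReward K (V θ) r - bestReward K w r)) p :=
    (hib.sub (integrable_const _)).const_mul _
  have hi2 : Integrable (fun θ => (∑ i ∈ S, (V θ i - w i) ^ 2) / (768 * K ^ 5)) p :=
    (integrable_finsetSum _ fun i _ => hid2 i).div_const _
  have hi3 : Integrable (fun θ => η * (bestReward K (V θ) r - bestReward K w r)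
      - (∑ i ∈ S, (V θ i - w i) ^ 2) / (768 * K ^ 5)) p := hi1.sub hi2
  have hie1 : ∀ o, Integrable
      (fun θ => mnlProb S w o * (Real.exp (logRatio K η S o (V θ) w r) - 1)) p :=
    fun o => ((hie o).sub (integrable_const 1)).const_mul _
  calc ∑ o, mnlProb S w o * Real.log (∫ θ, Real.exp (logRatio K η S o (V θ) w r) ∂p)
      ≤ ∑ o, mnlProb S w o * (∫ θ, Real.exp (logRatio K η S o (V θ) w r) ∂p - 1) :=
        Finset.sum_le_sum fun o _ => mul_le_mul_of_nonneg_left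
          (Real.log_le_sub_one_of_pos (integral_exp_pos (hie o))) (mnlProb_nonneg hw S o)
    _ = ∫ θ, ∑ o, mnlProb S w o * (Real.exp (logRatio K η S o (V θ) w r) - 1) ∂p := by
        rw [integral_finsetSum _ fun o _ => hie1 o]
        refine Finset.sum_congr rfl fun o _ => ?_
        rw [integral_const_mul, integral_sub (hie o) (integrable_const 1)]
        simp
    _ ≤ ∫ θ, (η * (bestReward K (V θ) r - bestReward K w r)
          - (∑ i ∈ S, (V θ i - w i) ^ 2) / (768 * K ^ 5) + 10 * η ^ 2) ∂p := by
        refine integral_mono_ae (integrable_finsetSum _ fun o _ => hie1 o)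
          (hi3.add (integrable_const _)) ?_
        filter_upwards [hV] with θ hθ
        refine (sum_mnlProb_mul_exp_logRatio_le hK hKN hη hη' hθ hw hr S).trans ?_
        have h1 := sum_sq_sub_le hK hS hθ hw
        have h2 : (∑ i ∈ S, (V θ i - w i) ^ 2) / (768 * K ^ 5)
            ≤ (∑ i ∈ S, (mnlProb S (V θ) (some i) - mnlProb S w (some i)) ^ 2) / (48 * K) := by
          rw [div_le_div_iff₀ (by positivity) (by positivity)]
          calc _ ≤ (16 * K ^ 4 * ∑ i ∈ S,
                (mnlProb S (V θ) (some i) - mnlProb S w (some i)) ^ 2) * (48 * (K : ℝ)) := by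
                gcongr
            _ = _ := by ring
        linarith
    _ = _ := by
        rw [integral_add hi3 (integrable_const _), integral_sub hi1 hi2,
          integral_const_mul, integral_div, integral_sub hib (integrable_const _),
          integral_finsetSum _ fun i _ => hid2 i]
        simp

/-- One round: the regret, weighted by the learning rate, is paid for by the decrease of the
expected logarithm of the normalising constant, up to a second-order term. -/
lemma sum_offer_mul_regret_add_log_le [IsProbabilityMeasure p] {K : ℕ} (hK : 1 ≤ K)
    (hKN : K ≤ N) {η : ℝ} (hη : 0 < η) (hη' : η ≤ 3 / 4) (hVm : ∀ i, Measurable fun θ => V θ i)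
    (hV : ∀ᵐ θ ∂p, ∀ i, V θ i ∈ Set.Icc (0 : ℝ) 1) (hw : ∀ i, w i ∈ Set.Icc (0 : ℝ) 1)
    (hr : ∀ i, r i ∈ Set.Icc (0 : ℝ) 1) {select : (Fin N → ℝ) → (Fin N → ℝ) → Finset (Fin N)}
    (hsel : IsArgmaxRule K select) (hselm : ∀ S, MeasurableSet {θ | select (V θ) r = S}) :
    ∑ S, ∑ o, p.real {θ | select (V θ) r = S} * mnlProb S w o
        * (η * (bestReward K w r - expReward S w r)
          + Real.log (∫ θ, Real.exp (logRatio K η S o (V θ) w r) ∂p))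
      ≤ 202 * η ^ 2 * K ^ 5 * N := by
  have hK' : (1 : ℝ) ≤ K := by exact_mod_cast hK
  have hN' : (1 : ℝ) ≤ N := by exact_mod_cast hK.trans hKN
  set q : Finset (Fin N) → ℝ := fun S => p.real {θ | select (V θ) r = S} with hq
  have hq1 : ∑ S, q S = 1 := by
    have := integral_comp_finset (p := p) hselm fun _ => 1
    simpa using this.symm
  have hq0 : ∀ S, q S ≠ 0 → S.card ≤ K := by
    intro S hS
    by_contra hc
    refine hS ((measureReal_eq_zero_iff (measure_ne_top p _)).2 ?_)
    refine measure_mono_null ?_ hV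
    intro θ hθ hθV
    have hmem := (hsel (V θ) r hθV hr).1
    rw [show select (V θ) r = S from hθ] at hmem
    exact hc (Finset.mem_filter.1 hmem).2.2
  -- with this weight the decoupled error is exactly offset by the drift
  have hl : 0 < 1 / (768 * η * K ^ 5) := by positivity
  have hreg := sum_real_mul_regret_le hK hKN hVm hV hw hr hsel hselm hl
  set b := bestReward K w r with hb
  set B := ∫ θ, bestReward K (V θ) r ∂p with hB
  set D : Finset (Fin N) → ℝ := fun S => ∑ i ∈ S, ∫ θ, (V θ i - w i) ^ 2 ∂p with hD
  have hstep : ∀ S, ∑ o, q S * mnlProb S w o * (η * (b - expReward S w r)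
        + Real.log (∫ θ, Real.exp (logRatio K η S o (V θ) w r) ∂p))
      ≤ η * (q S * (b - expReward S w r))
        + q S * (η * (B - b) - D S / (768 * K ^ 5) + 10 * η ^ 2) := by
    intro S
    rcases eq_or_ne (q S) 0 with h0 | h0
    · simp [h0]
    have h1 := sum_mnlProb_mul_log_integral_le hK hKN hη hη' hVm hV hw hr (hq0 S h0)
    calc _ = q S * ((∑ o, mnlProb S w o) * (η * (b - expReward S w r))
            + ∑ o, mnlProb S w o
              * Real.log (∫ θ, Real.exp (logRatio K η S o (V θ) w r) ∂p)) := by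
          rw [Finset.sum_mul, ← Finset.sum_add_distrib, Finset.mul_sum]
          exact Finset.sum_congr rfl fun o _ => by ring
      _ ≤ q S * (1 * (η * (b - expReward S w r))
            + (η * (B - b) - D S / (768 * K ^ 5) + 10 * η ^ 2)) := by
          rw [sum_mnlProb hw]
          exact mul_le_mul_of_nonneg_left (by linarith) measureReal_nonneg
      _ = _ := by ring
  refine (Finset.sum_le_sum fun S _ => hstep S).trans ?_
  have hexpand : ∀ S, q S * (η * (B - b) - D S / (768 * K ^ 5) + 10 * η ^ 2)
      = (η * (B - b) + 10 * η ^ 2) * q S - 1 / (768 * K ^ 5) * (q S * D S) := by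
    intro S
    ring
  simp only [Finset.sum_add_distrib, hexpand, Finset.sum_sub_distrib, ← Finset.mul_sum, hq1]
  have h2 := mul_le_mul_of_nonneg_left hreg hη.le
  have h3 : η * (b - B + N / (4 * (1 / (768 * η * K ^ 5)))
        + 1 / (768 * η * K ^ 5) * ∑ S, q S * D S)
      = η * (b - B) + 192 * η ^ 2 * K ^ 5 * N + 1 / (768 * K ^ 5) * ∑ S, q S * D S := by
    field_simp
    ring
  have h4 : 10 * η ^ 2 ≤ 10 * η ^ 2 * (K ^ 5 * N) :=
    le_mul_of_one_le_right (by positivity) (one_le_mul_of_one_le_of_one_le (one_le_pow₀ hK') hN')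
  rw [h3] at h2
  linarith

end Sampling

/-! ### The play over all rounds -/

section Play

variable {Θ : Type} [MeasurableSpace Θ] {X : Type u} {N K : ℕ} {η : ℝ} {prior : Measure Θ}
  {value : Θ → X → Fin N → ℝ} {fstar : X → Fin N → ℝ} {adv : Adversary X N}
  {select : (Fin N → ℝ) → (Fin N → ℝ) → Finset (Fin N)}

/-- The standing assumptions of the regret analysis. The values of the class have to lie in `[0,1]`
only up to a null set of the prior, since the exponential-linear class is parametrised by a whole
Euclidean space. -/
structure IsRegular (K : ℕ) (prior : Measure Θ) (value : Θ → X → Fin N → ℝ)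
    (fstar : X → Fin N → ℝ) (select : (Fin N → ℝ) → (Fin N → ℝ) → Finset (Fin N)) : Prop where
  one_le : 1 ≤ K
  le : K ≤ N
  isProbabilityMeasure : IsProbabilityMeasure prior
  measurable_value : ∀ x i, Measurable fun θ => value θ x i
  value_mem : ∀ᵐ θ ∂prior, ∀ x i, value θ x i ∈ Set.Icc (0 : ℝ) 1
  fstar_mem : ∀ x i, fstar x i ∈ Set.Icc (0 : ℝ) 1
  isArgmaxRule : IsArgmaxRule K select
  measurableSet_select : ∀ x r S, MeasurableSet {θ | select (value θ x) r = S}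

lemma tilted_add_const (p : Measure Θ) (g : Θ → ℝ) (c : ℝ) :
    p.tilted (fun θ => g θ + c) = p.tilted g := by
  simp only [Measure.tilted, Real.exp_add, integral_mul_const]
  congr 1
  ext θ
  rw [mul_div_mul_right _ _ (Real.exp_pos c).ne']

/-- Normalising the loss by that of the true value function does not change the update. -/
lemma fgtsDist_cons (fstar : X → Fin N → ℝ) (S : Finset (Fin N)) (o : Option (Fin N))
    (h : History N) :
    fgtsDist K η prior value adv ((S, o) :: h)
      = (fgtsDist K η prior value adv h).tilted fun θ =>
        logRatio K η S o (value θ (adv.context h)) (fstar (adv.context h)) (adv.reward h) := by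
  rw [fgtsDist, ← tilted_add_const _ _
    (-(-η * fgLoss K η S o (fstar (adv.context h)) (adv.reward h)))]
  simp only [logRatio, sub_eq_add_neg]

lemma fgtsDist_regular (hreg : IsRegular K prior value fstar select) (hη : 0 < η)
    (adv : Adversary X N) (h : History N) :
    IsProbabilityMeasure (fgtsDist K η prior value adv h) ∧
      fgtsDist K η prior value adv h ≪ prior := by
  induction h with
  | nil => exact ⟨hreg.isProbabilityMeasure, Measure.AbsolutelyContinuous.rfl⟩
  | cons a h ih =>
    obtain ⟨S, o⟩ := a
    obtain ⟨hp, hac⟩ := ih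
    rw [fgtsDist_cons fstar]
    refine ⟨isProbabilityMeasure_tilted ?_, (tilted_absolutelyContinuous _ _).trans hac⟩
    exact integrable_exp_logRatio hreg.one_le hreg.le hη (hreg.measurable_value _)
      (Filter.Eventually.mono (hac.ae_le hreg.value_mem) fun θ hθ => hθ _)
      (hreg.fstar_mem _) (adv.reward_mem h) S o

lemma ae_fgtsDist_value_mem (hreg : IsRegular K prior value fstar select) (hη : 0 < η)
    (adv : Adversary X N) (h : History N) :
    ∀ᵐ θ ∂fgtsDist K η prior value adv h,
      ∀ i, value θ (adv.context h) i ∈ Set.Icc (0 : ℝ) 1 :=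
  Filter.Eventually.mono ((fgtsDist_regular hreg hη adv h).2.ae_le hreg.value_mem)
    fun _ hθ => hθ _

lemma mem_assortments_of_offerProb_ne_zero (hreg : IsRegular K prior value fstar select)
    (hη : 0 < η) {h : History N} {S : Finset (Fin N)}
    (hS : offerProb K η prior value adv select h S ≠ 0) : S ∈ assortments N K := by
  by_contra hc
  have := (fgtsDist_regular hreg hη adv h).1
  refine hS ((measureReal_eq_zero_iff (measure_ne_top _ _)).2 ?_)
  refine measure_mono_null ?_ (ae_fgtsDist_value_mem hreg hη adv h)
  intro θ hθ hθV
  have hmem := (hreg.isArgmaxRule _ _ hθV (adv.reward_mem h)).1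
  rw [show select (value θ (adv.context h)) (adv.reward h) = S from hθ] at hmem
  exact hc hmem

lemma sum_offerProb (hreg : IsRegular K prior value fstar select) (hη : 0 < η)
    (h : History N) : ∑ S, offerProb K η prior value adv select h S = 1 := by
  have := (fgtsDist_regular hreg hη adv h).1
  have h1 := integral_comp_finset (p := fgtsDist K η prior value adv h)
    (hreg.measurableSet_select (adv.context h) (adv.reward h)) fun _ => 1
  simpa [offerProb] using h1.symm

lemma sum_offerProb_mul_mnlProb (hreg : IsRegular K prior value fstar select) (hη : 0 < η)
    (h : History N) :
    ∑ S, ∑ o, offerProb K η prior value adv select h S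
      * mnlProb S (fstar (adv.context h)) o = 1 := by
  simp only [← Finset.mul_sum, sum_mnlProb (hreg.fstar_mem _), mul_one]
  exact sum_offerProb hreg hη h

lemma historyProb_nonneg (hreg : IsRegular K prior value fstar select) (h : History N) :
    0 ≤ historyProb K η prior value fstar adv select h := by
  induction h with
  | nil => exact zero_le_one
  | cons a h ih =>
    exact mul_nonneg (mul_nonneg ih measureReal_nonneg) (mnlProb_nonneg (hreg.fstar_mem _) _ _)

lemma sum_ofFn_succ (T : ℕ) (F : History N → ℝ) :
    ∑ ω : Fin (T + 1) → Round N, F (List.ofFn ω)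
      = ∑ ω : Fin T → Round N, ∑ S, ∑ o, F ((S, o) :: List.ofFn ω) := by
  rw [← (Fin.consEquiv fun _ => Round N).sum_comp, Fintype.sum_prod_type, Finset.sum_comm]
  refine Finset.sum_congr rfl fun ω _ => ?_
  rw [Fintype.sum_prod_type]
  simp [Fin.consEquiv, List.ofFn_succ]

lemma sum_historyProb (hreg : IsRegular K prior value fstar select) (hη : 0 < η) (T : ℕ) :
    ∑ ω : Fin T → Round N, historyProb K η prior value fstar adv select (List.ofFn ω) = 1 := by
  induction T with
  | zero => simp [historyProb]
  | succ T ih =>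
    rw [sum_ofFn_succ, ← ih]
    refine Finset.sum_congr rfl fun ω _ => ?_
    simp only [historyProb, mul_assoc, ← Finset.mul_sum]
    rw [mul_right_eq_self₀]
    left
    have := sum_offerProb_mul_mnlProb (adv := adv) hreg hη (List.ofFn ω)
    simpa only [← Finset.mul_sum] using this

/-- If the expected increase of a functional of the play is at most `c` in every round, then its
expectation after `T` rounds is at most `T * c`. -/
lemma sum_historyProb_mul_le (hreg : IsRegular K prior value fstar select) (hη : 0 < η)
    {F : History N → ℝ} {c : ℝ} (h0 : F [] = 0)
    (hF : ∀ h, ∑ S, ∑ o, offerProb K η prior value adv select h S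
      * mnlProb S (fstar (adv.context h)) o * (F ((S, o) :: h) - F h) ≤ c) (T : ℕ) :
    ∑ ω : Fin T → Round N, historyProb K η prior value fstar adv select (List.ofFn ω)
      * F (List.ofFn ω) ≤ T * c := by
  induction T with
  | zero => simp [h0]
  | succ T ih =>
    rw [sum_ofFn_succ T fun h => historyProb K η prior value fstar adv select h * F h]
    have hω : ∀ ω : Fin T → Round N,
        ∑ S, ∑ o, historyProb K η prior value fstar adv select ((S, o) :: List.ofFn ω)
            * F ((S, o) :: List.ofFn ω)
          ≤ historyProb K η prior value fstar adv select (List.ofFn ω) * F (List.ofFn ω)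
            + historyProb K η prior value fstar adv select (List.ofFn ω) * c := by
      intro ω
      rw [← mul_add]
      have h1 : F (List.ofFn ω) = ∑ S, ∑ o, offerProb K η prior value adv select (List.ofFn ω) S
          * mnlProb S (fstar (adv.context (List.ofFn ω))) o * F (List.ofFn ω) := by
        simp only [← Finset.sum_mul]
        rw [sum_offerProb_mul_mnlProb hreg hη, one_mul]
      have h2 := hF (List.ofFn ω)
      simp only [mul_sub, Finset.sum_sub_distrib] at h2
      rw [← h1] at h2
      have h3 : ∑ S, ∑ o, historyProb K η prior value fstar adv select ((S, o) :: List.ofFn ω)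
            * F ((S, o) :: List.ofFn ω)
          = historyProb K η prior value fstar adv select (List.ofFn ω)
            * ∑ S, ∑ o, offerProb K η prior value adv select (List.ofFn ω) S
              * mnlProb S (fstar (adv.context (List.ofFn ω))) o * F ((S, o) :: List.ofFn ω) := by
        simp only [historyProb, mul_assoc, Finset.mul_sum]
      rw [h3]
      exact mul_le_mul_of_nonneg_left (by linarith) (historyProb_nonneg hreg _)
    refine (Finset.sum_le_sum fun ω _ => hω ω).trans ?_
    rw [Finset.sum_add_distrib, ← Finset.sum_mul, sum_historyProb hreg hη]
    push_cast
    linarith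

/-- The logarithm of the prior expectation of the accumulated weights relative to the true value
function, written as the sum of the logarithms of the normalising constants of the updates. -/
noncomputable def logPotential (K : ℕ) (η : ℝ) (prior : Measure Θ)
    (value : Θ → X → Fin N → ℝ) (fstar : X → Fin N → ℝ) (adv : Adversary X N) : History N → ℝ
  | [] => 0
  | (S, o) :: h =>
    logPotential K η prior value fstar adv h
      + Real.log (∫ θ, Real.exp (logRatio K η S o (value θ (adv.context h))
          (fstar (adv.context h)) (adv.reward h)) ∂fgtsDist K η prior value adv h)

/-- The potential cannot fall below the prior mass of a set of parameters whose relative weight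
falls by a factor of at most `exp a` in every round. -/
lemma exp_mul_real_le_exp_logPotential (hreg : IsRegular K prior value fstar select)
    (hη : 0 < η) {E : Set Θ} (hE : MeasurableSet E) {a : ℝ}
    (ha : ∀ x r S o, (∀ i, r i ∈ Set.Icc (0 : ℝ) 1) → S ∈ assortments N K →
      ∀ θ ∈ E, -a ≤ logRatio K η S o (value θ x) (fstar x) r)
    {h : History N} (hh : historyProb K η prior value fstar adv select h ≠ 0) :
    Real.exp (-(h.length * a)) * prior.real E
      ≤ Real.exp (logPotential K η prior value fstar adv h)
        * (fgtsDist K η prior value adv h).real E := by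
  induction h with
  | nil => simp [logPotential, fgtsDist]
  | cons so h ih =>
    obtain ⟨S, o⟩ := so
    simp only [historyProb] at hh
    have hS := mem_assortments_of_offerProb_ne_zero hreg hη
      (right_ne_zero_of_mul (left_ne_zero_of_mul hh))
    have ih := ih (left_ne_zero_of_mul (left_ne_zero_of_mul hh))
    have hp := (fgtsDist_regular hreg hη adv h).1
    have hint := integrable_exp_logRatio (p := fgtsDist K η prior value adv h) hreg.one_le
      hreg.le hη (hreg.measurable_value _) (ae_fgtsDist_value_mem hreg hη adv h)
      (hreg.fstar_mem (adv.context h)) (adv.reward_mem h) S o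
    rw [fgtsDist_cons fstar, logPotential]
    set p := fgtsDist K η prior value adv h with hpdef
    set g : Θ → ℝ := fun θ => logRatio K η S o (value θ (adv.context h)) (fstar (adv.context h))
      (adv.reward h) with hg
    have hpos : 0 < ∫ θ, Real.exp (g θ) ∂p := integral_exp_pos hint
    have h1 : Real.exp (-a) * p.real E ≤ ∫ θ in E, Real.exp (g θ) ∂p := by
      have h2 : ∫ _ in E, Real.exp (-a) ∂p ≤ ∫ θ in E, Real.exp (g θ) ∂p :=
        setIntegral_mono_on (integrable_const _).integrableOn hint.integrableOn hE
          fun θ hθ => Real.exp_le_exp.2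
            (ha (adv.context h) (adv.reward h) S o (adv.reward_mem h) hS θ hθ)
      rwa [setIntegral_const, smul_eq_mul, mul_comm] at h2
    have h2 : (p.tilted g).real E = (∫ θ in E, Real.exp (g θ) ∂p) / ∫ θ, Real.exp (g θ) ∂p := by
      rw [measureReal_def, tilted_apply_eq_ofReal_integral' _ hE, integral_div,
        ENNReal.toReal_ofReal]
      exact div_nonneg (integral_nonneg fun _ => (Real.exp_pos _).le) hpos.le
    rw [h2, Real.exp_add, Real.exp_log hpos, mul_assoc, mul_div_cancel₀ _ hpos.ne']
    calc Real.exp (-((((S, o) :: h).length : ℕ) * a)) * prior.real E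
        = Real.exp (-a) * (Real.exp (-(h.length * a)) * prior.real E) := by
          rw [← mul_assoc, ← Real.exp_add]
          congr 2
          push_cast [List.length_cons]
          ring
      _ ≤ Real.exp (-a) * (Real.exp (logPotential K η prior value fstar adv h) * p.real E) :=
          mul_le_mul_of_nonneg_left ih (Real.exp_pos _).le
      _ = Real.exp (logPotential K η prior value fstar adv h) * (Real.exp (-a) * p.real E) := by
          ring
      _ ≤ _ := mul_le_mul_of_nonneg_left h1 (Real.exp_pos _).le

/-- The regret bound in terms of the prior mass `exp (-G)` of an `ε`-neighbourhood of the true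
value function. -/
theorem regret_le_of_prior_mass (hreg : IsRegular K prior value fstar select) (hη : 0 < η)
    (hη' : η ≤ 3 / 4) {E : Set Θ} (hE : MeasurableSet E) {ε G : ℝ}
    (hEv : ∀ θ ∈ E, ∀ x i, value θ x i ∈ Set.Icc (0 : ℝ) 1 ∧ |value θ x i - fstar x i| ≤ ε)
    (hG : Real.exp (-G) ≤ prior.real E) (adv : Adversary X N) (T : ℕ) :
    η * regret K η prior value fstar adv select T
      ≤ T * (ε / 2 + η * K * ε) + G + T * (202 * η ^ 2 * K ^ 5 * N) := by
  have hstep : ∀ h, ∑ S, ∑ o, offerProb K η prior value adv select h S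
      * mnlProb S (fstar (adv.context h)) o
      * ((η * cumRegret K fstar adv ((S, o) :: h)
          + logPotential K η prior value fstar adv ((S, o) :: h))
        - (η * cumRegret K fstar adv h + logPotential K η prior value fstar adv h))
      ≤ 202 * η ^ 2 * K ^ 5 * N := by
    intro h
    have := (fgtsDist_regular hreg hη adv h).1
    refine le_trans (le_of_eq ?_) (sum_offer_mul_regret_add_log_le
      (p := fgtsDist K η prior value adv h) hreg.one_le hreg.le hη hη'
      (hreg.measurable_value (adv.context h)) (ae_fgtsDist_value_mem hreg hη adv h)
      (hreg.fstar_mem (adv.context h)) (adv.reward_mem h) hreg.isArgmaxRule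
      (hreg.measurableSet_select _ _))
    refine Finset.sum_congr rfl fun S _ => Finset.sum_congr rfl fun o _ => ?_
    simp only [offerProb, cumRegret, logPotential]
    ring
  have hup := sum_historyProb_mul_le (F := fun h => η * cumRegret K fstar adv h
    + logPotential K η prior value fstar adv h) hreg hη (by simp [cumRegret, logPotential])
    hstep T
  have hlow : ∀ ω : Fin T → Round N,
      historyProb K η prior value fstar adv select (List.ofFn ω)
          * -(T * (ε / 2 + η * K * ε) + G)
        ≤ historyProb K η prior value fstar adv select (List.ofFn ω)
          * logPotential K η prior value fstar adv (List.ofFn ω) := by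
    intro ω
    rcases eq_or_ne (historyProb K η prior value fstar adv select (List.ofFn ω)) 0 with h0 | h0
    · simp [h0]
    refine mul_le_mul_of_nonneg_left ?_ (historyProb_nonneg hreg _)
    have h1 := exp_mul_real_le_exp_logPotential hreg hη hE (a := ε / 2 + η * K * ε)
      (fun x r S o hr hS θ hθ => neg_le_logRatio hreg.one_le hreg.le hη
        (fun i => (hEv θ hθ x i).1) (hreg.fstar_mem x) hr (Finset.mem_filter.1 hS).2.2 o
        fun i => (hEv θ hθ x i).2) h0
    have := (fgtsDist_regular hreg hη adv (List.ofFn ω)).1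
    have h2 := mul_le_of_le_one_right
      (Real.exp_pos (logPotential K η prior value fstar adv (List.ofFn ω))).le
      (measureReal_le_one (μ := fgtsDist K η prior value adv (List.ofFn ω)) (s := E))
    have h3 := mul_le_mul_of_nonneg_left hG
      (Real.exp_pos (-((List.ofFn ω).length * (ε / 2 + η * K * ε)))).le
    rw [← Real.exp_add, List.length_ofFn] at h3
    rw [List.length_ofFn] at h1
    have h4 := Real.exp_le_exp.1 (h3.trans (h1.trans h2))
    linarith
  have hlow := Finset.sum_le_sum fun ω (_ : ω ∈ Finset.univ) => hlow ω
  rw [← Finset.sum_mul, sum_historyProb hreg hη, one_mul] at hlow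
  simp only [mul_add (historyProb _ _ _ _ _ _ _ _), Finset.sum_add_distrib, mul_left_comm _ η,
    ← Finset.mul_sum] at hup
  rw [regret]
  linarith

/-- A bound on the expected regret of a single round adds up over the rounds. -/
lemma regret_le_of_forall_round (hreg : IsRegular K prior value fstar select) (hη : 0 < η)
    (adv : Adversary X N) {c : ℝ}
    (hc : ∀ h, ∑ S, offerProb K η prior value adv select h S
      * (bestReward K (fstar (adv.context h)) (adv.reward h)
        - expReward S (fstar (adv.context h)) (adv.reward h)) ≤ c) (T : ℕ) :
    regret K η prior value fstar adv select T ≤ T * c := by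
  refine sum_historyProb_mul_le hreg hη rfl (fun h => ?_) T
  refine le_trans (le_of_eq ?_) (hc h)
  refine Finset.sum_congr rfl fun S _ => ?_
  simp only [cumRegret, add_sub_cancel_left, ← Finset.sum_mul, ← Finset.mul_sum,
    sum_mnlProb (hreg.fstar_mem _), mul_one]

lemma regret_le_horizon (hreg : IsRegular K prior value fstar select) (hη : 0 < η)
    (adv : Adversary X N) (T : ℕ) :
    regret K η prior value fstar adv select T ≤ T := by
  have := regret_le_of_forall_round (c := 1) hreg hη adv (fun h => ?_) T
  · simpa using this
  rw [← sum_offerProb (adv := adv) hreg hη h]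
  refine Finset.sum_le_sum fun S _ => mul_le_of_le_one_right measureReal_nonneg ?_
  have h1 := (bestReward_mem hreg.one_le hreg.le (hreg.fstar_mem (adv.context h))
    (adv.reward_mem h)).2
  have h2 := (expReward_mem (hreg.fstar_mem (adv.context h)) (adv.reward_mem h) S).1
  linarith

end Play

/-! ### The learning rate -/

section Tuning

/-- The learning rate that balances the two terms of the regret bound, capped where the
second-order expansion of the exponential stops being valid. -/
noncomputable def learningRate (N K T : ℕ) (G : ℝ) : ℝ :=
  min (Real.sqrt (G / (K ^ 5 * (N * T)))) (3 / 4)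

lemma learningRate_pos {N K T : ℕ} {G : ℝ} (hK : 1 ≤ K) (hKN : K ≤ N) (hT : 1 ≤ T) (hG : 0 < G) :
    0 < learningRate N K T G := by
  have hK' : (0 : ℝ) < K := by exact_mod_cast hK
  have hN' : (0 : ℝ) < N := by exact_mod_cast hK.trans hKN
  have hT' : (0 : ℝ) < T := by exact_mod_cast hT
  exact lt_min (Real.sqrt_pos.2 (by positivity)) (by norm_num)

lemma rpow_five_halves_mul_sqrt (K : ℕ) (x : ℝ) :
    (K : ℝ) ^ (5 / 2 : ℝ) * Real.sqrt x = Real.sqrt (K ^ 5 * x) := by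
  rw [Real.sqrt_mul (by positivity), Real.sqrt_eq_rpow ((K : ℝ) ^ 5), ← Real.rpow_natCast,
    ← Real.rpow_mul (by positivity)]
  norm_num

variable {Θ : Type} [MeasurableSpace Θ] {X : Type u} {N K : ℕ} {prior : Measure Θ}
  {value : Θ → X → Fin N → ℝ} {fstar : X → Fin N → ℝ}
  {select : (Fin N → ℝ) → (Fin N → ℝ) → Finset (Fin N)}

/-- The regret of the tuned algorithm. Besides the prior mass of the `ε`-neighbourhood, the bound
needs `ε` to be small enough for the approximation error accumulated over `T` rounds to stay below
`G` and below a constant. -/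
theorem regret_learningRate_le (hreg : IsRegular K prior value fstar select) {E : Set Θ}
    (hE : MeasurableSet E) {ε G : ℝ} {T : ℕ} (hT : 1 ≤ T) (hG : 0 < G)
    (hTG : T * ε ≤ 2 * G) (hT2 : T * ε ≤ 2)
    (hEv : ∀ θ ∈ E, ∀ x i, value θ x i ∈ Set.Icc (0 : ℝ) 1 ∧ |value θ x i - fstar x i| ≤ ε)
    (hmass : Real.exp (-G) ≤ prior.real E) (adv : Adversary X N) :
    regret K (learningRate N K T G) prior value fstar adv select T
      ≤ 206 * ((K : ℝ) ^ (5 / 2 : ℝ) * Real.sqrt (N * T * G)) := by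
  have hK' : (1 : ℝ) ≤ K := by exact_mod_cast hreg.one_le
  have hN' : (1 : ℝ) ≤ N := by exact_mod_cast hreg.one_le.trans hreg.le
  have hT' : (1 : ℝ) ≤ T := by exact_mod_cast hT
  have hη := learningRate_pos hreg.one_le hreg.le hT hG
  have hη' : learningRate N K T G ≤ 3 / 4 := min_le_right _ _
  rw [rpow_five_halves_mul_sqrt, ← mul_assoc]
  set M : ℝ := K ^ 5 * (N * T) with hM
  set Q := Real.sqrt (M * G) with hQ
  have hKM : (K : ℝ) ^ 2 * T ≤ M := by
    have h1 : (K : ℝ) ^ 2 ≤ K ^ 5 := pow_le_pow_right₀ hK' (by norm_num)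
    have h2 : (T : ℝ) ≤ N * T := le_mul_of_one_le_left (by linarith) hN'
    rw [hM]
    gcongr
  have hM1 : 1 ≤ M := by
    rw [hM]
    exact one_le_mul_of_one_le_of_one_le (one_le_pow₀ hK')
      (one_le_mul_of_one_le_of_one_le hN' hT')
  have hM0 : 0 < M := by linarith
  have hTM : (T : ℝ) ≤ M := by
    have : 1 * (T : ℝ) ≤ K ^ 2 * T := by
      gcongr
      exact one_le_pow₀ hK'
    linarith
  have hQ0 : 0 < Q := Real.sqrt_pos.2 (by positivity)
  have hQ2 : Q ^ 2 = M * G := Real.sq_sqrt (by positivity)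
  rcases le_total (Real.sqrt (G / M)) (3 / 4) with hc | hc
  · have hηeq : learningRate N K T G = Real.sqrt (G / M) := min_eq_left hc
    have hb := regret_le_of_prior_mass hreg hη hη' hE hEv hmass adv T
    set η := learningRate N K T G
    have hη2 : η ^ 2 = G / M := by rw [hηeq]; exact Real.sq_sqrt (by positivity)
    have hηQ : η * Q = G := by
      rw [hηeq, hQ, ← Real.sqrt_mul (by positivity),
        show G / M * (M * G) = G * G by field_simp, Real.sqrt_mul_self hG.le]
    have hηM : 202 * η ^ 2 * M = 202 * G := by rw [hη2]; field_simp
    -- the accumulated approximation error of the best rewards, by `min (2 * G) 2 ≤ 2 * √G`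
    have hKT : K * (T * ε) ≤ 2 * Q := by
      rcases le_total (T * ε) 0 with h0 | h0
      · exact (mul_nonpos_of_nonneg_of_nonpos (by positivity) h0).trans (by positivity)
      · refine abs_le_of_sq_le_sq' ?_ (by positivity) |>.2
        have h1 : (T * ε) ^ 2 ≤ 2 * G * 2 := by
          rw [sq]
          exact mul_le_mul hTG hT2 h0 (by positivity)
        have h2 : (K : ℝ) ^ 2 ≤ M := (le_mul_of_one_le_right (by positivity) hT').trans hKM
        calc (K * (T * ε)) ^ 2 = K ^ 2 * (T * ε) ^ 2 := by ring
          _ ≤ M * (2 * G * 2) := by gcongr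
          _ = (2 * Q) ^ 2 := by rw [mul_pow, hQ2]; ring
    have h3 : η * regret K η prior value fstar adv select T ≤ η * (206 * Q) := by
      have h4 : (T : ℝ) * (202 * η ^ 2 * K ^ 5 * N) = 202 * η ^ 2 * M := by
        rw [hM]
        ring
      have h5 := mul_le_mul_of_nonneg_left hKT hη.le
      calc _ ≤ T * (ε / 2 + η * K * ε) + G + T * (202 * η ^ 2 * K ^ 5 * N) := hb
        _ = T * ε / 2 + η * (K * (T * ε)) + G + 202 * G := by
            rw [h4, hηM]
            ring
        _ ≤ G + η * (2 * Q) + G + 202 * G := by linarith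
        _ = 206 * (η * Q) := by rw [← hηQ]; ring
        _ = _ := by ring
    exact le_of_mul_le_mul_left h3 hη
  · -- for a large class relative to the horizon the trivial bound `T` is good enough
    refine (regret_le_horizon hreg hη adv T).trans ?_
    have h1 : 9 / 16 ≤ G / M := by
      have := (Real.le_sqrt (by norm_num) (by positivity)).1 hc
      linarith
    rw [le_div_iff₀ hM0] at h1
    have h2 : (T : ℝ) ≤ 2 * Q := by
      refine abs_le_of_sq_le_sq' ?_ (by positivity) |>.2
      rw [mul_pow, hQ2]
      nlinarith
    linarith

end Tuning

/-! ### Finite classes -/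

section FiniteClass

variable {X : Type u} {N K n : ℕ} {f : Fin n → X → Fin N → ℝ}
  {select : (Fin N → ℝ) → (Fin N → ℝ) → Finset (Fin N)}

lemma isRegular_finite (hK : 1 ≤ K) (hKN : K ≤ N) (hf : ∀ m x i, f m x i ∈ Set.Icc (0 : ℝ) 1)
    (m₀ : Fin n) (hsel : IsArgmaxRule K select) :
    IsRegular K (uniformOn Set.univ) f (f m₀) select where
  one_le := hK
  le := hKN
  isProbabilityMeasure :=
    isProbabilityMeasure_uniformOn Set.finite_univ ⟨m₀, Set.mem_univ _⟩
  measurable_value _ _ := .of_discrete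
  value_mem := .of_forall hf
  fstar_mem := hf m₀
  isArgmaxRule := hsel
  measurableSet_select _ _ _ := .of_discrete

lemma uniformOn_real_singleton (m₀ : Fin n) :
    (uniformOn (Set.univ : Set (Fin n))).real {m₀} = (n : ℝ)⁻¹ := by
  rw [measureReal_def, uniformOn_univ]
  simp

/-- A class with a single function is learned without regret. -/
lemma regret_le_zero_of_subsingleton {f : Fin 1 → X → Fin N → ℝ} {m₀ : Fin 1} {η : ℝ}
    (hreg : IsRegular K (uniformOn Set.univ) f (f m₀) select) (hη : 0 < η)
    (adv : Adversary X N) (T : ℕ) :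
    regret K η (uniformOn Set.univ) f (f m₀) adv select T ≤ 0 := by
  refine (regret_le_of_forall_round (c := 0) hreg hη adv (fun h => ?_) T).trans_eq (mul_zero _)
  refine (Finset.sum_eq_zero fun S _ => ?_).le
  rcases Set.eq_empty_or_nonempty
    {θ | select (f θ (adv.context h)) (adv.reward h) = S} with h0 | ⟨θ, hθ⟩
  · simp [offerProb, h0]
  · rw [Subsingleton.elim θ m₀] at hθ
    have hS : select (f m₀ (adv.context h)) (adv.reward h) = S := hθ
    rw [bestReward_eq_of_isArgmaxRule hreg.one_le hreg.le hreg.isArgmaxRule (hreg.fstar_mem _)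
      (adv.reward_mem h), hS, sub_self, mul_zero]

end FiniteClass

/-! ### The exponential-linear class -/

section LinearClass

variable {d N K : ℕ} {X : Set (Fin N → EuclideanSpace ℝ (Fin d))} {B : ℝ}

lemma abs_exp_sub_exp_le {a b : ℝ} (ha : a ≤ 0) (hb : b ≤ 0) :
    |Real.exp a - Real.exp b| ≤ |a - b| := by
  wlog h : b ≤ a generalizing a b
  · rw [abs_sub_comm, abs_sub_comm a]
    exact this hb ha (le_of_not_ge h)
  rw [abs_of_nonneg (sub_nonneg.2 (Real.exp_le_exp.2 h)), abs_of_nonneg (sub_nonneg.2 h)]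
  have h1 : Real.exp b = Real.exp a * Real.exp (b - a) := by
    rw [← Real.exp_add]
    ring_nf
  have h2 := Real.add_one_le_exp (b - a)
  have h3 := Real.exp_le_one_iff.2 ha
  have h4 := Real.exp_pos a
  rw [h1]
  nlinarith

lemma inner_sub_nonpos (hX : ∀ x ∈ X, ∀ i, ‖x i‖ ≤ 1) {θ : EuclideanSpace ℝ (Fin d)}
    (hθ : ‖θ‖ ≤ B) (x : X) (i : Fin N) : inner ℝ θ (x.1 i) - B ≤ 0 := by
  have h1 := real_inner_le_norm θ (x.1 i)
  have h2 := mul_le_of_le_one_right (norm_nonneg θ) (hX x.1 x.2 i)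
  linarith

lemma linValue_mem (hX : ∀ x ∈ X, ∀ i, ‖x i‖ ≤ 1) {θ : EuclideanSpace ℝ (Fin d)}
    (hθ : ‖θ‖ ≤ B) (x : X) (i : Fin N) : linValue X B θ x i ∈ Set.Icc (0 : ℝ) 1 :=
  ⟨(Real.exp_pos _).le, Real.exp_le_one_iff.2 (inner_sub_nonpos hX hθ x i)⟩

lemma abs_linValue_sub_le (hX : ∀ x ∈ X, ∀ i, ‖x i‖ ≤ 1) {θ θ' : EuclideanSpace ℝ (Fin d)}
    (hθ : ‖θ‖ ≤ B) (hθ' : ‖θ'‖ ≤ B) (x : X) (i : Fin N) :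
    |linValue X B θ x i - linValue X B θ' x i| ≤ ‖θ - θ'‖ := by
  refine (abs_exp_sub_exp_le (inner_sub_nonpos hX hθ x i) (inner_sub_nonpos hX hθ' x i)).trans ?_
  rw [sub_sub_sub_cancel_right, ← inner_sub_left]
  exact (abs_real_inner_le_norm _ _).trans
    (mul_le_of_le_one_right (norm_nonneg _) (hX x.1 x.2 i))

lemma isRegular_linValue {select : (Fin N → ℝ) → (Fin N → ℝ) → Finset (Fin N)} (hK : 1 ≤ K)
    (hKN : K ≤ N) (hB : 0 < B) (hX : ∀ x ∈ X, ∀ i, ‖x i‖ ≤ 1)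
    {θstar : EuclideanSpace ℝ (Fin d)} (hθ : ‖θstar‖ ≤ B) (hsel : IsArgmaxRule K select)
    (hselm : ∀ r S, MeasurableSet {v | select v r = S}) :
    IsRegular K (cond volume (Metric.closedBall 0 B)) (linValue X B) (linValue X B θstar)
      select := by
  have hm : ∀ x i, Measurable fun θ => linValue X B θ x i := by
    intro x i
    simp only [linValue]
    fun_prop
  exact {
    one_le := hK
    le := hKN
    isProbabilityMeasure := cond_isProbabilityMeasure_of_finite
      (Metric.measure_closedBall_pos volume 0 hB).ne' measure_closedBall_lt_top.ne
    measurable_value := hm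
    value_mem := by
      filter_upwards [ae_cond_mem Metric.isClosed_closedBall.measurableSet] with θ h x i
      exact linValue_mem hX (mem_closedBall_zero_iff.1 h) x i
    fstar_mem := linValue_mem hX hθ
    isArgmaxRule := hsel
    measurableSet_select := fun x r S =>
      measurable_pi_lambda (fun θ => linValue X B θ x) (hm x) (hselm r S) }

/-- The copy of the ball shrunk by the factor `s` towards one of its points lies in the ball and
has the fraction `s ^ d` of its volume. -/
lemma cond_real_image_homothety (hB : 0 < B) {θstar : EuclideanSpace ℝ (Fin d)}
    (hθ : ‖θstar‖ ≤ B) {s : ℝ} (hs0 : 0 ≤ s) (hs1 : s ≤ 1) :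
    AffineMap.homothety θstar s '' Metric.closedBall 0 B ⊆ Metric.closedBall 0 B ∧
    MeasurableSet (AffineMap.homothety θstar s '' Metric.closedBall 0 B) ∧
    (cond volume (Metric.closedBall (0 : EuclideanSpace ℝ (Fin d)) B)).real
      (AffineMap.homothety θstar s '' Metric.closedBall 0 B) = s ^ d := by
  have hsub : AffineMap.homothety θstar s '' Metric.closedBall 0 B ⊆ Metric.closedBall 0 B := by
    rintro _ ⟨θ, hθ', rfl⟩
    rw [AffineMap.homothety_eq_lineMap]
    exact (convex_closedBall (0 : EuclideanSpace ℝ (Fin d)) B).lineMap_mem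
      (mem_closedBall_zero_iff.2 hθ) hθ' ⟨hs0, hs1⟩
  refine ⟨hsub, ?_, ?_⟩
  · exact ((isCompact_closedBall _ _).image
      (AffineMap.homothety_continuous _ _)).isClosed.measurableSet
  · rw [measureReal_def, cond_apply Metric.isClosed_closedBall.measurableSet,
      Set.inter_eq_self_of_subset_right hsub, Measure.addHaar_image_homothety,
      ENNReal.toReal_mul, ENNReal.toReal_mul, ENNReal.toReal_inv,
      ENNReal.toReal_ofReal (abs_nonneg _), abs_of_nonneg (by positivity),
      finrank_euclideanSpace_fin, mul_left_comm, inv_mul_cancel₀, mul_one]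
    exact (ENNReal.toReal_pos (Metric.measure_closedBall_pos volume 0 hB).ne'
      measure_closedBall_lt_top.ne).ne'

theorem regret_linValue_le {select : (Fin N → ℝ) → (Fin N → ℝ) → Finset (Fin N)} {T : ℕ}
    (hK : 1 ≤ K) (hKN : K ≤ N) (hT : 1 ≤ T) (hd : 1 ≤ d) (hB : 0 < B)
    (hX : ∀ x ∈ X, ∀ i, ‖x i‖ ≤ 1) {θstar : EuclideanSpace ℝ (Fin d)} (hθ : ‖θstar‖ ≤ B)
    (hsel : IsArgmaxRule K select) (hselm : ∀ r S, MeasurableSet {v | select v r = S})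
    (adv : Adversary X N) :
    regret K (learningRate N K T (d * max 1 (Real.log (B * T))))
        (cond volume (Metric.closedBall 0 B)) (linValue X B) (linValue X B θstar) adv select T
      ≤ 206 * ((K : ℝ) ^ (5 / 2 : ℝ)
        * Real.sqrt (N * T * (d * max 1 (Real.log (B * T))))) := by
  have hT' : (1 : ℝ) ≤ T := by exact_mod_cast hT
  have hd' : (1 : ℝ) ≤ d := by exact_mod_cast hd
  have hBT : 0 < B * T := by positivity
  set L := max 1 (Real.log (B * T)) with hL
  have hG : 1 ≤ d * L := one_le_mul_of_one_le_of_one_le hd' (le_max_left _ _)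
  set s := min 1 (1 / (B * T)) with hs
  have hs0 : 0 < s := lt_min one_pos (by positivity)
  obtain ⟨hsub, hmeas, hmass⟩ := cond_real_image_homothety hB hθ hs0.le (min_le_left _ _)
  have hTε : T * (2 * B * s) ≤ 2 := by
    have : s * (B * T) ≤ 1 := by
      rw [← le_div_iff₀ hBT]
      exact min_le_right _ _
    linarith
  refine regret_learningRate_le (isRegular_linValue hK hKN hB hX hθ hsel hselm) hmeas hT
    (by linarith) (hTε.trans (by linarith)) hTε ?_ ?_ adv
  · rintro _ ⟨θ, hθ', rfl⟩ x i
    have hmem := mem_closedBall_zero_iff.1 (hsub ⟨θ, hθ', rfl⟩)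
    refine ⟨linValue_mem hX hmem x i, (abs_linValue_sub_le hX hmem hθ x i).trans ?_⟩
    have h1 : AffineMap.homothety θstar s θ - θstar = s • (θ - θstar) := by
      simp [AffineMap.homothety_apply]
    rw [h1, norm_smul, Real.norm_of_nonneg hs0.le]
    have h2 := norm_sub_le θ θstar
    have h3 := mem_closedBall_zero_iff.1 hθ'
    nlinarith
  · rw [hmass, ← mul_neg, mul_comm, Real.exp_mul, Real.rpow_natCast]
    refine pow_le_pow_left₀ (Real.exp_pos _).le (le_min ?_ ?_) d
    · exact Real.exp_le_one_iff.2 (by linarith [le_max_left 1 (Real.log (B * T))])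
    · rw [one_div, ← Real.exp_log (inv_pos.2 hBT), Real.log_inv]
      exact Real.exp_le_exp.2 (neg_le_neg (le_max_right _ _))

end LinearClass

end MNLBandit

/-! ### The regret bounds -/

theorem mainTheorem5 :
    -- finite classes
    (∃ C : ℝ, 0 < C ∧
      ∀ N K T n : ℕ, 1 ≤ K → K ≤ N → 1 ≤ T →
      ∃ η : ℝ, 0 < η ∧
      ∀ (X : Type u) (f : Fin n → X → Fin N → ℝ),
        Function.Injective f → (∀ m x i, f m x i ∈ Set.Icc (0 : ℝ) 1) →
      ∀ (m₀ : Fin n) (adv : MNLBandit.Adversary X N)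
        (select : (Fin N → ℝ) → (Fin N → ℝ) → Finset (Fin N)),
        MNLBandit.IsArgmaxRule K select →
        MNLBandit.regret K η (ProbabilityTheory.uniformOn Set.univ) f (f m₀) adv select T
          ≤ C * ((K : ℝ) ^ (5 / 2 : ℝ) * Real.sqrt (N * T * Real.log n))) ∧
    -- the linear class
    (∃ C : ℝ, 0 < C ∧
      ∀ (N K T d : ℕ) (B : ℝ), 1 ≤ K → K ≤ N → 1 ≤ T → 1 ≤ d → 0 < B →
      ∃ η : ℝ, 0 < η ∧
      ∀ X : Set (Fin N → EuclideanSpace ℝ (Fin d)), (∀ x ∈ X, ∀ i, ‖x i‖ ≤ 1) →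
      ∀ θstar : EuclideanSpace ℝ (Fin d), ‖θstar‖ ≤ B →
      ∀ (adv : MNLBandit.Adversary X N)
        (select : (Fin N → ℝ) → (Fin N → ℝ) → Finset (Fin N)),
        MNLBandit.IsArgmaxRule K select →
        (∀ r S, MeasurableSet {v | select v r = S}) →
        MNLBandit.regret K η
            (ProbabilityTheory.cond MeasureTheory.volume (Metric.closedBall 0 B))
            (MNLBandit.linValue X B) (MNLBandit.linValue X B θstar) adv select T
          ≤ C * ((K : ℝ) ^ (5 / 2 : ℝ) *
              Real.sqrt (d * N * T * max 1 (Real.log (B * T))))) := by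
  refine ⟨⟨206, by norm_num, fun N K T n hK hKN hT => ?_⟩,
    ⟨206, by norm_num, fun N K T d B hK hKN hT hd hB => ?_⟩⟩
  · rcases Nat.lt_or_ge 1 n with hn | hn
    · have hG : 0 < Real.log n := Real.log_pos (by exact_mod_cast hn)
      refine ⟨MNLBandit.learningRate N K T (Real.log n),
        MNLBandit.learningRate_pos hK hKN hT hG, ?_⟩
      intro X f _ hf m₀ adv select hsel
      refine MNLBandit.regret_learningRate_le (MNLBandit.isRegular_finite hK hKN hf m₀ hsel)
        (E := {m₀}) (ε := 0) .of_discrete hT hG (by linarith) (by norm_num) ?_ ?_ adv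
      · rintro _ rfl x i
        exact ⟨hf _ x i, by simp⟩
      · rw [MNLBandit.uniformOn_real_singleton, Real.exp_neg,
          Real.exp_log (by exact_mod_cast Nat.zero_lt_of_lt hn)]
    · -- here the bound is `0`, which no positive learning rate balances
      refine ⟨1, one_pos, ?_⟩
      intro X f _ hf m₀ adv select hsel
      obtain rfl : n = 1 := by
        have := m₀.pos
        omega
      exact (MNLBandit.regret_le_zero_of_subsingleton
        (MNLBandit.isRegular_finite hK hKN hf m₀ hsel) one_pos adv T).trans (by positivity)
  · have hG : 0 < d * max 1 (Real.log (B * T)) :=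
      mul_pos (by exact_mod_cast hd) (lt_max_of_lt_left one_pos)
    refine ⟨_, MNLBandit.learningRate_pos hK hKN hT hG, ?_⟩
    intro X hX θstar hθ adv select hsel hselm
    refine (MNLBandit.regret_linValue_le hK hKN hT hd hB hX hθ hsel hselm adv).trans_eq ?_
    congr 3
    ring
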